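/- Let $k$ be an algebraically closed field of characteristic $0$ or greater than $5$. Let $S = k[[\alpha_1,\alpha_2]]$ with maximal ideal $\mathfrak m$, and let $P = k_{dp}[x_1,x_2]$ be the divided power ring, regarded as the space of $k$-linear functionals on $S$ vanishing on some power of $\mathfrak m$, with basis $x^{[a]}$ dual to the monomials $\alpha^a$; let $P_{\le d}$ be the span of the $x^{[a]}$ with $|a|\le d$. For $f\in P$ let $\sigma\lrcorner f$ be the functional $\tau\mapsto f(\tau\sigma)$, and put $\operatorname{Ann}(f)=\{\sigma\in S : \sigma\lrcorner f=0\}$ and $\operatorname{Apolar}(f)=S/\operatorname{Ann}(f)$. The Hilbert function of a local $k$-algebra $(A,\mathfrak m_A)$ with residue field $k$ is $i\mapsto\dim_k\mathfrak m_A^i/\mathfrak m_A^{i+1}$, and $A$ is canonically graded if it is isomorphic, as a $k$-algebra, to $\bigoplus_i\mathfrak m_A^i/\mathfrak m_A^{i+1}$. Let $G^+$ be the group of $k$-linear automorphisms of $S$ generated by the $k$-algebra automorphisms $\varphi$ with $\varphi(\alpha_i)-\alpha_i\in\mathfrak m^2$ for all $i$ and by the multiplications by elements of $1+\mathfrak m$;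 it acts on functionals by precomposition. Let $f_5$ be the homogeneous part of degree $5$ of $f$. Let $U\subset P_{\le 5}$ be the set of those $f$ such that $\operatorname{Apolar}(f)$ is local with Hilbert function $(1,2,3,3,2,1)$ and no nonzero cubic form in $\operatorname{Ann}(f_5)$ is a power of a linear form. Then $U$ is a nonempty Zariski open subset of the affine space $P_{\le 5}$ (so a general $f \in P_{\le 5}$ belongs to $U$), and every $f\in U$ satisfies: 1. $f$ has degree exactly $5$, and both $\operatorname{Apolar}(f)$ and $\operatorname{Apolar}(f_5)$ have Hilbert function $(1,2,3,3,2,1)$; 2. $G^+\cdot f_5=f_5+P_{\le 4}$; 3. $\operatorname{Apolar}(f)\simeq\operatorname{Apolar}(f_5)$ as $k$-algebras, and $\operatorname{Apolar}(f)$ is canonically graded. -/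

import Mathlib

open MvPowerSeries

noncomputable section

namespace Macaulay

/-- The power series ring `S = k[[α₁, …, αₙ]]`. -/
abbrev PS (k : Type*) [Field k] (n : ℕ) : Type _ := MvPowerSeries (Fin n) k

/-- The maximal ideal `𝔪` of `S`. -/
abbrev maxIdeal (k : Type*) [Field k] (n : ℕ) : Ideal (PS k n) :=
  IsLocalRing.maximalIdeal (PS k n)

/-- The divided power monomial `x^[a]`: the functional on `S` dual to the monomial `α^a`. -/
def dpMonomial (k : Type*) [Field k] {n : ℕ} (a : Fin n →₀ ℕ) : Module.Dual k (PS k n) :=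
  MvPowerSeries.coeff a

/-- `P_{≤ d}`: divided power polynomials of degree at most `d`, that is, the span in the dual
space of `S` of the monomials `x^[a]` with `|a| ≤ d`. -/
def dpLE (k : Type*) [Field k] (n d : ℕ) : Submodule k (Module.Dual k (PS k n)) :=
  Submodule.span k {g | ∃ a : Fin n →₀ ℕ, a.degree ≤ d ∧ g = dpMonomial k a}

/-- The homogeneous part `f_d` of degree `d` of a divided power polynomial `f`: it pairs with `σ`
as `f` pairs with the degree `d` part of `σ`. -/
def homPart {k : Type*} [Field k] {n : ℕ} (d : ℕ) (f : Module.Dual k (PS k n)) :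
    Module.Dual k (PS k n) :=
  f ∘ₗ MvPowerSeries.homogeneousComponent d

/-- Contraction `σ ⌟ f`, given by `⟨τ, σ ⌟ f⟩ = ⟨τ σ, f⟩`. -/
def contract {k : Type*} [Field k] {n : ℕ} (σ : PS k n) (f : Module.Dual k (PS k n)) :
    Module.Dual k (PS k n) :=
  f ∘ₗ LinearMap.mulRight k σ

/-- The apolar ideal `Ann(f) = {σ | σ ⌟ f = 0}`. -/
def apolarIdeal {k : Type*} [Field k] {n : ℕ} (f : Module.Dual k (PS k n)) : Ideal (PS k n) where
  carrier := {σ | contract σ f = 0}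
  zero_mem' := by
    ext τ
    simp [contract]
  add_mem' := by
    intro a b ha hb
    ext τ
    have h1 := LinearMap.congr_fun ha τ
    have h2 := LinearMap.congr_fun hb τ
    simp only [contract, LinearMap.comp_apply, LinearMap.mulRight_apply,
      LinearMap.zero_apply] at h1 h2 ⊢
    rw [mul_add, map_add, h1, h2, add_zero]
  smul_mem' := by
    intro c a ha
    ext τ
    have h1 := LinearMap.congr_fun ha (τ * c)
    simp only [contract, LinearMap.comp_apply, LinearMap.mulRight_apply,
      LinearMap.zero_apply, smul_eq_mul] at h1 ⊢
    rw [← mul_assoc, h1]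

/-- The apolar algebra `Apolar(f) = S / Ann(f)`. -/
abbrev Apolar {k : Type*} [Field k] {n : ℕ} (f : Module.Dual k (PS k n)) : Type _ :=
  PS k n ⧸ apolarIdeal f

/-- The `k`-algebra `A` is local, and its Hilbert function `i ↦ dim_k 𝔪^i / 𝔪^(i+1)` is `H`. -/
def HasHilbertFunction (k A : Type*) [Field k] [CommRing A] [Algebra k A] (H : ℕ → ℕ) : Prop :=
  ∃ _ : IsLocalRing A, ∀ i : ℕ,
    Module.finrank k
      ((IsLocalRing.maximalIdeal A ^ i : Ideal A) ⧸
        (IsLocalRing.maximalIdeal A • ⊤ :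
          Submodule A (IsLocalRing.maximalIdeal A ^ i : Ideal A))) = H i

/-- The associated graded ring `gr_I(A) = ⨁ I^i / I^(i+1)`, as the Rees algebra of `I`
(which is `⨁ I^i t^i`) modulo the ideal generated by `I` (which is `⨁ I^(i+1) t^i`). -/
abbrev AssocGraded {A : Type*} [CommRing A] (I : Ideal A) : Type _ :=
  reesAlgebra I ⧸ I.map (algebraMap A (reesAlgebra I))

/-- The `k`-algebra `A` is local, and isomorphic to its associated graded algebra. -/
def IsCanonicallyGraded (k A : Type*) [Field k] [CommRing A] [Algebra k A] : Prop :=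
  ∃ _ : IsLocalRing A, Nonempty (A ≃ₐ[k] AssocGraded (IsLocalRing.maximalIdeal A))

/-- The group `G⁺ = Aut⁺(S) ⋉ (1 + 𝔪)`, inside the group of `k`-linear automorphisms of `S`. It is
generated by the `k`-algebra automorphisms `φ` of `S` with `φ(αᵢ) - αᵢ ∈ 𝔪²` for all `i`, and by
the multiplications by elements of `1 + 𝔪`. -/
def gPlus (k : Type*) [Field k] (n : ℕ) : Subgroup (PS k n ≃ₗ[k] PS k n) :=
  Subgroup.closure
    ({L | ∃ φ : PS k n ≃ₐ[k] PS k n,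
        (∀ i, φ (X i) - X i ∈ maxIdeal k n ^ 2) ∧ L = φ.toLinearEquiv} ∪
      {L | ∃ s : PS k n, s - 1 ∈ maxIdeal k n ∧ ∀ τ, L τ = s * τ})

/-- The orbit of `f` under `G⁺`, where `L` acts by the dual map: `⟨τ, L^∨ f⟩ = ⟨L τ, f⟩`. -/
def gPlusOrbit {k : Type*} [Field k] {n : ℕ} (f : Module.Dual k (PS k n)) :
    Set (Module.Dual k (PS k n)) :=
  {g | ∃ L ∈ gPlus k n, g = f ∘ₗ (L : PS k n →ₗ[k] PS k n)}

/-- A subset `U` of `P_{≤ d}` is Zariski open, for the affine space structure with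
coordinates the coefficients of the monomials `x^[a]`, `|a| ≤ d`. -/
def IsZariskiOpen {k : Type*} [Field k] {n d : ℕ} (U : Set (dpLE k n d)) : Prop :=
  ∃ J : Ideal (MvPolynomial {a : Fin n →₀ ℕ // a.degree ≤ d} k),
    ∀ f : dpLE k n d,
      f ∈ U ↔ (fun a => f.1 (monomial a.1 1)) ∉ MvPolynomial.zeroLocus k J

/-- The function with values `1, 2, 3, 3, 2, 1` at `0, …, 5`, and `0` afterwards. -/
def h123321 (i : ℕ) : ℕ := [1, 2, 3, 3, 2, 1].getD i 0

/-- No nonzero cubic form in `Ann(F)` is a power of a linear form. -/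
def CubicNotPower {k : Type*} [Field k] {n : ℕ} (F : Module.Dual k (PS k n)) : Prop :=
  ∀ c ∈ apolarIdeal F, c ≠ 0 → MvPowerSeries.homogeneousComponent 3 c = c →
    ∀ v : Fin n → k, c ≠ (∑ i, v i • (X i : PS k n)) ^ 3

end Macaulay

end

/-!
The orbit `G⁺ · f₅` is filled by successive approximation along the `𝔪`-adic filtration: it is all
of `f₅ + P_{≤ 4}` as soon as, in each degree `j ≤ 4`, the top forms of degree `j` of the tangent
space to the orbit at `f₅` span all forms of degree `j`. Dually, no nonzero form `σ` of degree `j`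
may be orthogonal to that tangent space. Orthogonality to the directions `s ⌟ f₅` kills `σ` when
`j ≤ 2`, because the catalecticant matrices of a quintic with Hilbert function `(1,2,3,3,2,1)` have
maximal rank. Orthogonality to the directions `(D σ) ⌟ f₅` given by vector fields `D` says that the
partial derivatives of `σ` lie in `Ann(f₅)`. For `j = 3` these are quadrics, so they vanish. For
`j = 4` both are multiples of the unique cubic `C ∈ Ann(f₅)`, and `∂₂(a C) = ∂₁(b C)` forces
`a = b = 0` exactly when the Hessian of `C` is nonzero, that is, when `C` is not the cube of a
linear form. The coefficients of `C` are the maximal minors of the `3 × 4` Hankel matrix of `f₅`,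
hence polynomials in the coefficients of `f`, and nonvanishing of the Hessian is an open condition.
-/

namespace Macaulay

section MaxIdealPowers

variable {k : Type*} [Field k] {n : ℕ}

theorem mem_maxIdeal_iff {σ : PS k n} : σ ∈ maxIdeal k n ↔ constantCoeff σ = 0 := by
  rw [IsLocalRing.mem_maximalIdeal, mem_nonunits_iff, MvPowerSeries.isUnit_iff_constantCoeff,
    isUnit_iff_ne_zero, not_not]

theorem X_mem_maxIdeal (i : Fin n) : (X i : PS k n) ∈ maxIdeal k n :=
  mem_maxIdeal_iff.2 (constantCoeff_X i)

theorem le_order_of_mem_maxIdeal_pow {e : ℕ} {σ : PS k n} (hσ : σ ∈ maxIdeal k n ^ e) :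
    (e : ℕ∞) ≤ σ.order := by
  induction e generalizing σ with
  | zero => simp
  | succ e ih =>
    rw [pow_succ] at hσ
    refine Submodule.mul_induction_on hσ (fun a ha b hb => ?_)
      fun a b ha hb => (le_min ha hb).trans min_order_le_add
    have hb : (1 : ℕ∞) ≤ b.order :=
      one_le_order_iff_constCoeff_eq_zero.2 (mem_maxIdeal_iff.1 hb)
    push_cast
    exact (add_le_add (ih ha) hb).trans le_order_mul

theorem monomial_mem_span_X_pow (b : Fin n →₀ ℕ) :
    (monomial b 1 : PS k n) ∈ Ideal.span (Set.range X) ^ b.degree := by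
  rw [MvPowerSeries.monomial_one_eq, Finsupp.prod, Finsupp.degree_apply,
    ← Finset.prod_pow_eq_pow_sum]
  exact Ideal.prod_mem_prod fun i _ =>
    Ideal.pow_mem_pow (Ideal.subset_span (Set.mem_range_self i)) _

theorem mem_span_X_pow_of_coeff_eq_zero {e : ℕ} {σ : PS k n}
    (hσ : ∀ a : Fin n →₀ ℕ, a.degree < e → coeff a σ = 0) :
    σ ∈ Ideal.span (Set.range X) ^ e := by
  classical
  have exists_factor : ∀ a : Fin n →₀ ℕ, ∃ b, e ≤ a.degree → b ≤ a ∧ b.degree = e := fun a => by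
    by_cases ha : e ≤ a.degree
    · obtain ⟨b, hb⟩ := Finsupp.exists_le_degree_eq a e ha
      exact ⟨b, fun _ => hb⟩
    · exact ⟨0, fun h => absurd h ha⟩
  choose factor hfactor using exists_factor
  -- Each monomial of `σ` is divided by one chosen monomial of degree `e`.
  let quot (b : Fin n →₀ ℕ) : PS k n := fun a => if factor (a + b) = b then coeff (a + b) σ else 0
  have hsum : σ = ∑ b ∈ Finset.univ.finsuppAntidiag e, monomial b 1 * quot b := by
    ext a
    have hterm (b : Fin n →₀ ℕ) : coeff a (monomial b 1 * quot b) =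
        if b ≤ a ∧ factor a = b then coeff a σ else 0 := by
      rw [coeff_monomial_mul, one_mul, ite_and]
      refine ite_congr rfl (fun h => ?_) fun _ => rfl
      change (if factor (a - b + b) = b then coeff (a - b + b) σ else 0) = _
      rw [tsub_add_cancel_of_le h]
    rw [map_sum, Finset.sum_congr rfl fun b _ => hterm b]
    rcases lt_or_ge a.degree e with ha | ha
    · simp [hσ a ha]
    · obtain ⟨hle, hdeg⟩ := hfactor a ha
      rw [Finset.sum_eq_single_of_mem (factor a) (by simpa [Finsupp.degree_eq_sum] using hdeg)
        fun b _ hb => if_neg fun h => hb h.2.symm, if_pos ⟨hle, rfl⟩]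
  rw [hsum]
  refine Ideal.sum_mem _ fun b hb => Ideal.mul_mem_right _ _ ?_
  have hdeg : b.degree = e := by simpa [Finsupp.degree_eq_sum] using hb
  exact hdeg ▸ monomial_mem_span_X_pow b

theorem maxIdeal_eq_span : maxIdeal k n = Ideal.span (Set.range X) := by
  refine le_antisymm (fun σ hσ => ?_) (Ideal.span_le.2 ?_)
  · rw [← pow_one (Ideal.span _)]
    refine mem_span_X_pow_of_coeff_eq_zero fun a ha => ?_
    rw [(Finsupp.degree_eq_zero_iff a).1 (Nat.lt_one_iff.1 ha)]
    exact mem_maxIdeal_iff.1 hσ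
  · rintro _ ⟨i, rfl⟩
    exact X_mem_maxIdeal i

theorem mem_maxIdeal_pow_iff {e : ℕ} {σ : PS k n} :
    σ ∈ maxIdeal k n ^ e ↔ ∀ a : Fin n →₀ ℕ, a.degree < e → coeff a σ = 0 := by
  refine ⟨fun h a ha => coeff_of_lt_order
    (lt_of_lt_of_le (mod_cast ha) (le_order_of_mem_maxIdeal_pow h)), fun h => ?_⟩
  rw [maxIdeal_eq_span]
  exact mem_span_X_pow_of_coeff_eq_zero h

theorem exists_eq_sum_X_mul {e : ℕ} {σ : PS k n} (hσ : σ ∈ maxIdeal k n ^ (e + 1)) :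
    ∃ τ : Fin n → PS k n, (∀ i, τ i ∈ maxIdeal k n ^ e) ∧ σ = ∑ i, X i * τ i := by
  rw [pow_succ'] at hσ
  induction hσ using Submodule.mul_induction_on' with
  | mem_mul_mem a ha b hb =>
    rw [maxIdeal_eq_span, Ideal.span, Submodule.mem_span_range_iff_exists_fun] at ha
    obtain ⟨c, rfl⟩ := ha
    refine ⟨fun i => c i * b, fun i => Ideal.mul_mem_left _ _ hb, ?_⟩
    rw [Finset.sum_mul]
    exact Finset.sum_congr rfl fun i _ => by rw [smul_eq_mul]; ring
  | add a _ b _ ha hb =>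
    obtain ⟨τ, hτ, rfl⟩ := ha
    obtain ⟨τ', hτ', rfl⟩ := hb
    refine ⟨τ + τ', fun i => Ideal.add_mem _ (hτ i) (hτ' i), ?_⟩
    simp only [Pi.add_apply, mul_add, Finset.sum_add_distrib]

theorem eq_zero_of_forall_mem_maxIdeal_pow {σ : PS k n} (h : ∀ e, σ ∈ maxIdeal k n ^ e) :
    σ = 0 := by
  ext a
  exact mem_maxIdeal_pow_iff.1 (h (a.degree + 1)) a (Nat.lt_succ_self _)

theorem exists_sub_sum_range_mem_maxIdeal_pow {u : ℕ → PS k n}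
    (hu : ∀ i, u i ∈ maxIdeal k n ^ i) :
    ∃ y, ∀ e, y - ∑ i ∈ Finset.range e, u i ∈ maxIdeal k n ^ e := by
  obtain ⟨y, hy⟩ : ∃ y : PS k n, ∀ a : Fin n →₀ ℕ,
      coeff a y = coeff a (∑ i ∈ Finset.range (a.degree + 1), u i) := ⟨_, fun _ => rfl⟩
  refine ⟨y, fun e => mem_maxIdeal_pow_iff.2 fun a ha => ?_⟩
  have htail : coeff a (∑ i ∈ Finset.Ico (a.degree + 1) e, u i) = 0 := by
    rw [map_sum]
    exact Finset.sum_eq_zero fun i hi => mem_maxIdeal_pow_iff.1 (hu i) a (Finset.mem_Ico.1 hi).1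
  rw [map_sub, hy, ← Finset.sum_range_add_sum_Ico u (Nat.succ_le_of_lt ha), map_add, htail,
    add_zero, sub_self]

theorem sub_homogeneousComponent_mem {j : ℕ} {σ : PS k n} (hσ : σ ∈ maxIdeal k n ^ j) :
    σ - homogeneousComponent j σ ∈ maxIdeal k n ^ (j + 1) := by
  rw [mem_maxIdeal_pow_iff] at hσ ⊢
  intro a ha
  rw [map_sub, coeff_homogeneousComponent]
  split_ifs with h
  · exact sub_self _
  · rw [hσ a (by lia), sub_zero]

theorem homogeneousComponent_mem_maxIdeal_pow (j : ℕ) (σ : PS k n) :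
    homogeneousComponent j σ ∈ maxIdeal k n ^ j := by
  rw [mem_maxIdeal_pow_iff]
  intro a ha
  rw [coeff_homogeneousComponent, if_neg ha.ne]

theorem mem_maxIdeal_pow_of_X_pow_mul_mem {i : Fin n} {m e : ℕ} {σ : PS k n}
    (h : X i ^ m * σ ∈ maxIdeal k n ^ (m + e)) : σ ∈ maxIdeal k n ^ e := by
  rw [mem_maxIdeal_pow_iff] at h ⊢
  intro a ha
  have := h (Finsupp.single i m + a) (by simpa using ha)
  rwa [X_pow_eq, coeff_add_monomial_mul, one_mul] at this

theorem pderiv_mem_maxIdeal_pow {j : ℕ} {σ : PS k n} (hσ : σ ∈ maxIdeal k n ^ (j + 1))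
    (i : Fin n) : pderiv k i σ ∈ maxIdeal k n ^ j := by
  rw [mem_maxIdeal_pow_iff] at hσ ⊢
  intro a ha
  rw [coeff_pderiv, hσ _ (by simpa using ha), zero_mul]

theorem mem_maxIdeal_pow_succ_of_forall_pderiv_mem {j : ℕ} (hj : (j : k) ≠ 0) {σ : PS k n}
    (hσ : σ ∈ maxIdeal k n ^ j) (h : ∀ i, pderiv k i σ ∈ maxIdeal k n ^ j) :
    σ ∈ maxIdeal k n ^ (j + 1) := by
  refine mem_maxIdeal_pow_iff.2 fun a ha => ?_
  rcases Nat.lt_succ_iff_lt_or_eq.1 ha with ha | ha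
  · exact mem_maxIdeal_pow_iff.1 hσ a ha
  obtain ⟨i, hi⟩ : ∃ i, (a i : k) ≠ 0 := by
    by_contra! hzero
    rw [← ha, Finsupp.degree_eq_sum, Nat.cast_sum] at hj
    exact hj (Finset.sum_eq_zero fun i _ => hzero i)
  obtain ⟨b, rfl⟩ : ∃ b, a = b + Finsupp.single i 1 := by
    have hai : a i ≠ 0 := fun h0 => hi (by rw [h0, Nat.cast_zero])
    exact ⟨_, (tsub_add_cancel_of_le (Finsupp.single_le_iff.2 (Nat.one_le_iff_ne_zero.2 hai))).symm⟩
  rw [map_add, Finsupp.degree_single] at ha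
  have hderiv := mem_maxIdeal_pow_iff.1 (h i) b (by lia)
  rw [coeff_pderiv] at hderiv
  rw [Finsupp.add_apply, Finsupp.single_eq_same, Nat.cast_add_one] at hi
  exact (mul_eq_zero.1 hderiv).resolve_right hi

end MaxIdealPowers

section DividedPowers

variable {k : Type*} [Field k] {n : ℕ}

theorem contract_apply (σ : PS k n) (f : Module.Dual k (PS k n)) (τ : PS k n) :
    contract σ f τ = f (τ * σ) := rfl

theorem homPart_apply (d : ℕ) (f : Module.Dual k (PS k n)) (σ : PS k n) :
    homPart d f σ = f (homogeneousComponent d σ) := rfl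

theorem mem_apolarIdeal {f : Module.Dual k (PS k n)} {σ : PS k n} :
    σ ∈ apolarIdeal f ↔ ∀ τ, f (τ * σ) = 0 :=
  LinearMap.ext_iff

/-- `P_{< e}`: the functionals on `S` that vanish on `𝔪 ^ e`. -/
noncomputable def dpLT (k : Type*) [Field k] (n e : ℕ) : Submodule k (Module.Dual k (PS k n)) :=
  ((maxIdeal k n ^ e).restrictScalars k).dualAnnihilator

theorem mem_dpLT {e : ℕ} {f : Module.Dual k (PS k n)} :
    f ∈ dpLT k n e ↔ ∀ σ ∈ maxIdeal k n ^ e, f σ = 0 := by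
  simp [dpLT, Submodule.mem_dualAnnihilator]

theorem dpLT_mono {d e : ℕ} (h : d ≤ e) : dpLT k n d ≤ dpLT k n e := fun _ hf =>
  mem_dpLT.2 fun σ hσ => mem_dpLT.1 hf σ (Ideal.pow_le_pow_right h hσ)

theorem forall_mem_dpLT_apply_eq_zero_iff {e : ℕ} {σ : PS k n} :
    (∀ f ∈ dpLT k n e, f σ = 0) ↔ σ ∈ maxIdeal k n ^ e :=
  Subspace.forall_mem_dualAnnihilator_apply_eq_zero_iff _ σ

theorem dpLT_le_of_forall_mem {e : ℕ} {W : Submodule k (Module.Dual k (PS k n))}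
    [FiniteDimensional k W] (h : ∀ σ, (∀ g ∈ W, g σ = 0) → σ ∈ maxIdeal k n ^ e) :
    dpLT k n e ≤ W := by
  rw [← Subspace.dualCoannihilator_dualAnnihilator_eq (W := W)]
  refine fun f hf => (Submodule.mem_dualAnnihilator f).2 fun σ hσ => ?_
  exact mem_dpLT.1 hf σ (h σ fun g hg => (Submodule.mem_dualCoannihilator σ).1 hσ g hg)

theorem finite_degree_lt (n e : ℕ) : {a : Fin n →₀ ℕ | a.degree < e}.Finite :=
  (Finsupp.finite_of_degree_le e).subset fun _ ha => le_of_lt (Set.mem_ofPred.1 ha)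

theorem dpLT_eq_span (e : ℕ) :
    dpLT k n e = Submodule.span k (dpMonomial k '' {a : Fin n →₀ ℕ | a.degree < e}) := by
  have := FiniteDimensional.span_of_finite k ((finite_degree_lt n e).image (dpMonomial k))
  refine le_antisymm (dpLT_le_of_forall_mem fun σ hσ => ?_) (Submodule.span_le.2 ?_)
  · exact mem_maxIdeal_pow_iff.2 fun a ha => hσ _ (Submodule.subset_span ⟨a, ha, rfl⟩)
  · rintro _ ⟨a, ha, rfl⟩
    exact mem_dpLT.2 fun σ hσ => mem_maxIdeal_pow_iff.1 hσ a ha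

theorem dpLE_eq_dpLT (d : ℕ) : dpLE k n d = dpLT k n (d + 1) := by
  rw [dpLT_eq_span, dpLE]
  congr 1
  ext g
  simp [eq_comm]

theorem linearIndependent_dpMonomial :
    LinearIndependent k (dpMonomial k : (Fin n →₀ ℕ) → Module.Dual k (PS k n)) := by
  classical
  rw [linearIndependent_iff']
  intro s c hc a ha
  simpa [dpMonomial, coeff_monomial, ha] using LinearMap.congr_fun hc (monomial a 1)

instance finiteDimensional_dpLT (e : ℕ) : FiniteDimensional k (dpLT k n e) := by
  rw [dpLT_eq_span]
  exact FiniteDimensional.span_of_finite k ((finite_degree_lt n e).image _)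

theorem finrank_dpLT (e : ℕ) :
    Module.finrank k (dpLT k n e) = ∑ i ∈ Finset.range e, (n + i - 1).choose i := by
  classical
  let s : Finset (Fin n →₀ ℕ) := (Finset.range e).biUnion fun i => Finset.univ.finsuppAntidiag i
  have hs : {a : Fin n →₀ ℕ | a.degree < e} = s := by
    ext a
    simp [s, Finsupp.degree_eq_sum]
  have hdisj : Set.PairwiseDisjoint (Finset.range e : Set ℕ)
      fun i => (Finset.univ : Finset (Fin n)).finsuppAntidiag i := fun i _ j _ hij =>
    Finset.disjoint_left.2 fun a hi hj =>
      hij ((Finset.mem_finsuppAntidiag.1 hi).1.symm.trans (Finset.mem_finsuppAntidiag.1 hj).1)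
  have hindep : LinearIndependent k fun a : (s : Set (Fin n →₀ ℕ)) => dpMonomial k a.1 :=
    linearIndependent_dpMonomial.comp _ Subtype.val_injective
  rw [dpLT_eq_span, hs, Set.image_eq_range, finrank_span_eq_card hindep]
  simp [s, Finset.card_biUnion hdisj, Finset.card_finsuppAntidiag_nat_eq_choose]

end DividedPowers

section Unipotent

variable {k : Type*} [Field k] {n : ℕ}

/-- A linear endomorphism of `S` is unipotent if it preserves the filtration by the powers of `𝔪`
and induces the identity on every `𝔪 ^ j / 𝔪 ^ (j + 1)`. -/
def IsUnipotent (L : Module.End k (PS k n)) : Prop :=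
  ∀ ⦃j⦄, ∀ σ ∈ maxIdeal k n ^ j, L σ - σ ∈ maxIdeal k n ^ (j + 1)

namespace IsUnipotent

variable {L L' : Module.End k (PS k n)}

theorem map_mem (hL : IsUnipotent L) {j : ℕ} {σ : PS k n} (hσ : σ ∈ maxIdeal k n ^ j) :
    L σ ∈ maxIdeal k n ^ j := by
  rw [← sub_add_cancel (L σ) σ]
  exact Ideal.add_mem _ (Ideal.pow_le_pow_right (Nat.le_succ j) (hL σ hσ)) hσ

theorem mem_of_map_mem (hL : IsUnipotent L) {j : ℕ} {σ : PS k n} (hσ : L σ ∈ maxIdeal k n ^ j) :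
    σ ∈ maxIdeal k n ^ j := by
  induction j with
  | zero => simp
  | succ j ih =>
    rw [← sub_sub_cancel (L σ) σ]
    exact Ideal.sub_mem _ hσ (hL σ (ih (Ideal.pow_le_pow_right (Nat.le_succ j) hσ)))

theorem injective (hL : IsUnipotent L) : Function.Injective L :=
  (injective_iff_map_eq_zero L).2 fun σ hσ =>
    eq_zero_of_forall_mem_maxIdeal_pow fun e => hL.mem_of_map_mem (by rw [hσ]; exact zero_mem _)

theorem surjective (hL : IsUnipotent L) : Function.Surjective L := by
  intro τ
  -- The preimage is the geometric series `∑ (1 - L) ^ i τ`.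
  have hpow : ∀ i, ((1 - L) ^ i) τ ∈ maxIdeal k n ^ i := by
    intro i
    induction i with
    | zero => simp
    | succ i ih =>
      rw [pow_succ' (1 - L), Module.End.mul_apply, LinearMap.sub_apply, Module.End.one_apply,
        ← neg_sub]
      exact neg_mem (hL _ ih)
  obtain ⟨y, hy⟩ := exists_sub_sum_range_mem_maxIdeal_pow hpow
  refine ⟨y, sub_eq_zero.1 (eq_zero_of_forall_mem_maxIdeal_pow fun e => ?_)⟩
  have hgeom : L (∑ i ∈ Finset.range e, ((1 - L) ^ i) τ) = τ - ((1 - L) ^ e) τ := by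
    have := LinearMap.congr_fun (mul_neg_geom_sum (1 - L) e) τ
    simpa using this
  have hsplit : L y - τ = L (y - ∑ i ∈ Finset.range e, ((1 - L) ^ i) τ) - ((1 - L) ^ e) τ := by
    rw [map_sub, hgeom]
    ring
  rw [hsplit]
  exact sub_mem (hL.map_mem (hy e)) (hpow e)

theorem one : IsUnipotent (1 : Module.End k (PS k n)) := fun j σ _ => by simp

theorem mul (hL : IsUnipotent L) (hL' : IsUnipotent L') : IsUnipotent (L * L') := by
  intro j σ hσ
  rw [Module.End.mul_apply, ← sub_add_sub_cancel _ (L' σ) σ]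
  exact add_mem (hL _ (hL'.map_mem hσ)) (hL' σ hσ)

theorem of_mul_eq_one (hL : IsUnipotent L) (h : L * L' = 1) : IsUnipotent L' := by
  intro j σ hσ
  have hσ' : L (L' σ) = σ := LinearMap.congr_fun h σ
  have := hL (L' σ) (hL.mem_of_map_mem (hσ'.symm ▸ hσ))
  rw [hσ', ← neg_sub] at this
  exact neg_mem_iff.1 this

theorem mulLeft {s : PS k n} (hs : s - 1 ∈ maxIdeal k n) :
    IsUnipotent (LinearMap.mulLeft k s) := by
  intro j σ hσ
  have h : LinearMap.mulLeft k s σ - σ = (s - 1) * σ := by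
    rw [LinearMap.mulLeft_apply]
    ring
  rw [h, pow_succ']
  exact Ideal.mul_mem_mul hs hσ

end IsUnipotent

end Unipotent

section FirstOrder

variable {k : Type*} [Field k] {n : ℕ}

theorem linearMap_mem_of_commutator_X_mem {r : ℕ} {T : Module.End k (PS k n)} (hone : T 1 = 0)
    (hX : ∀ j i, ∀ τ ∈ maxIdeal k n ^ j, T (X i * τ) - X i * T τ ∈ maxIdeal k n ^ (j + r + 1))
    {j : ℕ} {σ : PS k n} (hσ : σ ∈ maxIdeal k n ^ j) : T σ ∈ maxIdeal k n ^ (j + r) := by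
  have hsum : ∀ {m e : ℕ} {τ : Fin n → PS k n}, (∀ i, τ i ∈ maxIdeal k n ^ m) →
      e ≤ m + r → (∀ i, T (τ i) ∈ maxIdeal k n ^ e) →
      T (∑ i, X i * τ i) ∈ maxIdeal k n ^ (e + 1) := by
    intro m e τ hτ he hT
    rw [map_sum]
    refine Ideal.sum_mem _ fun i _ => ?_
    rw [← sub_add_cancel (T (X i * τ i)) (X i * T (τ i))]
    refine Ideal.add_mem _ (Ideal.pow_le_pow_right (by lia) (hX m i _ (hτ i))) ?_
    rw [pow_succ']
    exact Ideal.mul_mem_mul (X_mem_maxIdeal i) (hT i)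
  induction j generalizing σ with
  | zero =>
    rw [zero_add]
    suffices ∀ e ≤ r, ∀ τ, T τ ∈ maxIdeal k n ^ e from this r le_rfl σ
    intro e
    induction e with
    | zero => simp
    | succ e ih =>
      intro he τ
      have hconst : τ - constantCoeff τ • 1 ∈ maxIdeal k n ^ (0 + 1) := by
        rw [zero_add, pow_one, mem_maxIdeal_iff]
        simp
      obtain ⟨υ, hυ, hτ⟩ := exists_eq_sum_X_mul hconst
      have hTτ : T τ = T (∑ i, X i * υ i) := by
        rw [← hτ, map_sub, map_smul, hone, smul_zero, sub_zero]
      rw [hTτ]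
      exact hsum hυ (by lia) fun i => ih (by lia) _
  | succ j ih =>
    obtain ⟨τ, hτ, rfl⟩ := exists_eq_sum_X_mul hσ
    rw [add_right_comm]
    exact hsum hτ le_rfl fun i => ih (hτ i)

/-- The derivation `∑ dᵢ ∂/∂αᵢ` of `S`. -/
noncomputable def vectorField (d : Fin n → PS k n) : Derivation k (PS k n) (PS k n) :=
  ∑ i, d i • pderiv k i

theorem vectorField_apply (d : Fin n → PS k n) (σ : PS k n) :
    vectorField d σ = ∑ i, d i * pderiv k i σ := by
  rw [vectorField, ← Derivation.coeFnAddMonoidHom_apply, map_sum, Finset.sum_apply]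
  rfl

theorem vectorField_X (d : Fin n → PS k n) (i : Fin n) : vectorField d (X i) = d i := by
  classical
  simp [vectorField_apply, pderiv_X, Pi.single_apply]

theorem vectorField_mem {r : ℕ} {d : Fin n → PS k n} (hd : ∀ i, d i ∈ maxIdeal k n ^ (r + 1))
    {j : ℕ} {σ : PS k n} (hσ : σ ∈ maxIdeal k n ^ j) :
    vectorField d σ ∈ maxIdeal k n ^ (j + r) := by
  rw [vectorField_apply]
  refine Ideal.sum_mem _ fun i _ => ?_
  cases j with
  | zero => exact Ideal.mul_mem_right _ _ (Ideal.pow_le_pow_right (by lia) (hd i))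
  | succ j =>
    rw [add_right_comm, add_assoc, add_comm, pow_add]
    exact Ideal.mul_mem_mul (hd i) (pderiv_mem_maxIdeal_pow hσ i)

variable {r : ℕ} {d : Fin n → PS k n} {φ : PS k n →ₐ[k] PS k n}

theorem algHom_mem_maxIdeal_pow (hφ : ∀ i, φ (X i) ∈ maxIdeal k n) {j : ℕ} {σ : PS k n}
    (hσ : σ ∈ maxIdeal k n ^ j) : φ σ ∈ maxIdeal k n ^ j := by
  have hle : maxIdeal k n ≤ (maxIdeal k n).comap φ := by
    conv_lhs => rw [maxIdeal_eq_span]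
    rw [Ideal.span_le]
    rintro _ ⟨i, rfl⟩
    exact hφ i
  exact (Ideal.pow_right_mono hle j).trans (Ideal.le_comap_pow φ j) hσ

theorem algHom_sub_self_mem (hd : ∀ i, d i ∈ maxIdeal k n ^ (r + 1))
    (hφ : ∀ i, φ (X i) = X i + d i) {j : ℕ} {σ : PS k n} (hσ : σ ∈ maxIdeal k n ^ j) :
    φ σ - σ ∈ maxIdeal k n ^ (j + r) := by
  have hφX : ∀ i, φ (X i) ∈ maxIdeal k n := fun i => by
    rw [hφ]
    exact Ideal.add_mem _ (X_mem_maxIdeal i) (Ideal.pow_le_self r.succ_ne_zero (hd i))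
  refine linearMap_mem_of_commutator_X_mem (T := φ.toLinearMap - 1) (by simp)
    (fun j i τ hτ => ?_) hσ
  have hcomm : (φ.toLinearMap - 1) (X i * τ) - X i * (φ.toLinearMap - 1) τ = φ τ * d i := by
    simp only [LinearMap.sub_apply, AlgHom.toLinearMap_apply, Module.End.one_apply, map_mul, hφ]
    ring
  rw [hcomm, add_assoc, pow_add]
  exact Ideal.mul_mem_mul (algHom_mem_maxIdeal_pow hφX hτ) (hd i)

theorem algHom_sub_self_sub_vectorField_mem (hd : ∀ i, d i ∈ maxIdeal k n ^ (r + 1))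
    (hφ : ∀ i, φ (X i) = X i + d i) {j : ℕ} {σ : PS k n} (hσ : σ ∈ maxIdeal k n ^ j) :
    φ σ - σ - vectorField d σ ∈ maxIdeal k n ^ (j + 2 * r) := by
  refine linearMap_mem_of_commutator_X_mem
    (T := φ.toLinearMap - 1 - (vectorField d).toLinearMap) (by simp) (fun j i τ hτ => ?_) hσ
  have hcomm : (φ.toLinearMap - 1 - (vectorField d).toLinearMap) (X i * τ) -
      X i * (φ.toLinearMap - 1 - (vectorField d).toLinearMap) τ = (φ τ - τ) * d i := by
    simp only [LinearMap.sub_apply, AlgHom.toLinearMap_apply, Module.End.one_apply, map_mul, hφ,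
      Derivation.coeFn_coe, Derivation.leibniz, vectorField_X,
      smul_eq_mul]
    ring
  rw [hcomm, two_mul, add_assoc, add_assoc, ← add_assoc, pow_add]
  exact Ideal.mul_mem_mul (algHom_sub_self_mem hd hφ hτ) (hd i)

theorem isUnipotent_algHom (hφ : ∀ i, φ (X i) - X i ∈ maxIdeal k n ^ 2) :
    IsUnipotent φ.toLinearMap := fun _ _ hσ =>
  algHom_sub_self_mem hφ (fun i => (add_sub_cancel (X i) (φ (X i))).symm) hσ

end FirstOrder

section Group

variable {k : Type*} [Field k] {n : ℕ}

theorem isUnipotent_of_mem_gPlus {L : PS k n ≃ₗ[k] PS k n} (hL : L ∈ gPlus k n) :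
    IsUnipotent (L : PS k n →ₗ[k] PS k n) := by
  induction hL using Subgroup.closure_induction with
  | mem L h =>
    rcases h with ⟨φ, hφ, rfl⟩ | ⟨s, hs, h⟩
    · exact isUnipotent_algHom (φ := φ.toAlgHom) hφ
    · exact (LinearMap.ext h : (L : PS k n →ₗ[k] PS k n) = LinearMap.mulLeft k s) ▸
        IsUnipotent.mulLeft hs
  | one => exact IsUnipotent.one
  | mul L L' _ _ h h' => exact h.mul h'
  | inv L _ h => exact h.of_mul_eq_one (LinearMap.ext L.apply_symm_apply)

theorem exists_algEquiv_map_mul_of_mem_gPlus {L : PS k n ≃ₗ[k] PS k n} (hL : L ∈ gPlus k n) :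
    ∃ φ : PS k n ≃ₐ[k] PS k n, ∀ τ σ, L (τ * σ) = L τ * φ σ := by
  induction hL using Subgroup.closure_induction with
  | mem L h =>
    rcases h with ⟨φ, -, rfl⟩ | ⟨s, -, h⟩
    · exact ⟨φ, map_mul φ⟩
    · exact ⟨AlgEquiv.refl, fun τ σ => by simp only [h, AlgEquiv.coe_refl, id_eq, mul_assoc]⟩
  | one => exact ⟨AlgEquiv.refl, fun _ _ => rfl⟩
  | mul L L' _ _ h h' =>
    obtain ⟨φ, hφ⟩ := h
    obtain ⟨φ', hφ'⟩ := h'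
    exact ⟨φ'.trans φ, fun τ σ => by
      simp only [LinearEquiv.mul_apply, hφ, hφ', AlgEquiv.trans_apply]⟩
  | inv L _ h =>
    obtain ⟨φ, hφ⟩ := h
    refine ⟨φ.symm, fun τ σ => L.symm_apply_eq.2 ?_⟩
    rw [hφ, φ.apply_symm_apply]
    exact congrArg (· * σ) (L.apply_symm_apply τ).symm

theorem nonempty_algEquiv_of_mem_gPlusOrbit {f g : Module.Dual k (PS k n)}
    (hg : g ∈ gPlusOrbit f) : Nonempty (Apolar g ≃ₐ[k] Apolar f) := by
  obtain ⟨L, hL, rfl⟩ := hg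
  obtain ⟨φ, hφ⟩ := exists_algEquiv_map_mul_of_mem_gPlus hL
  have hcomap : apolarIdeal (f ∘ₗ (L : PS k n →ₗ[k] PS k n)) =
      (apolarIdeal f).comap (φ : PS k n →+* PS k n) := by
    ext σ
    simp only [Ideal.mem_comap, mem_apolarIdeal, LinearMap.comp_apply, LinearEquiv.coe_coe, hφ]
    exact L.surjective.forall (p := fun τ => f (τ * φ σ) = 0).symm
  refine ⟨Ideal.quotientEquivAlg _ _ φ ?_⟩
  rw [hcomap]
  exact (Ideal.map_comap_of_surjective (φ : PS k n →+* PS k n) φ.surjective _).symm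

theorem exists_mem_gPlus_mul {s : PS k n} (hs : s ∈ maxIdeal k n) :
    ∃ L ∈ gPlus k n, ∀ σ, L σ = (1 + s) * σ := by
  have hs' : 1 + s - 1 ∈ maxIdeal k n := by rwa [add_sub_cancel_left]
  have hunip := IsUnipotent.mulLeft hs'
  exact ⟨LinearEquiv.ofBijective _ ⟨hunip.injective, hunip.surjective⟩,
    Subgroup.subset_closure (Or.inr ⟨1 + s, hs', fun _ => rfl⟩), fun _ => rfl⟩

theorem exists_algEquiv_X_add {d : Fin n → PS k n} (hd : ∀ i, d i ∈ maxIdeal k n ^ 2) :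
    ∃ φ : PS k n ≃ₐ[k] PS k n, (∀ i, φ (X i) = X i + d i) ∧ φ.toLinearEquiv ∈ gPlus k n := by
  have hsubst : HasSubst (fun i => (X i + d i : PS k n)) :=
    hasSubst_of_constantCoeff_zero fun i => mem_maxIdeal_iff.1
      (Ideal.add_mem _ (X_mem_maxIdeal i) (Ideal.pow_le_self two_ne_zero (hd i)))
  have hX : ∀ i, substAlgHom (R := k) hsubst (X i) = X i + d i := fun i => substAlgHom_X hsubst i
  have hX' : ∀ i, substAlgHom (R := k) hsubst (X i) - X i ∈ maxIdeal k n ^ 2 := fun i => by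
    rw [hX, add_sub_cancel_left]
    exact hd i
  have hunip := isUnipotent_algHom hX'
  exact ⟨AlgEquiv.ofBijective _ ⟨hunip.injective, hunip.surjective⟩, hX,
    Subgroup.subset_closure (Or.inl ⟨_, hX', rfl⟩)⟩

end Group

section Orbit

variable {k : Type*} [Field k] {n : ℕ}

theorem contract_mem_dpLT {d e : ℕ} {f : Module.Dual k (PS k n)} (hf : f ∈ dpLT k n (d + e))
    {s : PS k n} (hs : s ∈ maxIdeal k n ^ e) : contract s f ∈ dpLT k n d :=
  mem_dpLT.2 fun σ hσ => mem_dpLT.1 hf _ (by rw [pow_add]; exact Ideal.mul_mem_mul hσ hs)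

theorem IsUnipotent.comp_mem_dpLT {e : ℕ} {L : Module.End k (PS k n)} (hL : IsUnipotent L)
    {g : Module.Dual k (PS k n)} (hg : g ∈ dpLT k n e) : g ∘ₗ L ∈ dpLT k n e :=
  mem_dpLT.2 fun _ hσ => mem_dpLT.1 hg _ (hL.map_mem hσ)

theorem IsUnipotent.comp_sub_mem_dpLT {e : ℕ} {L : Module.End k (PS k n)} (hL : IsUnipotent L)
    {g : Module.Dual k (PS k n)} (hg : g ∈ dpLT k n (e + 1)) : g ∘ₗ L - g ∈ dpLT k n e :=
  mem_dpLT.2 fun σ hσ => by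
    rw [LinearMap.sub_apply, LinearMap.comp_apply, ← map_sub]
    exact mem_dpLT.1 hg _ (hL σ hσ)

/-- The directions `h ∈ P_{≤ j}` that are tangent to the `G⁺`-orbit of `f` modulo `P_{< j}`: every
`f + t h` with `t ∈ k` agrees with an element of the orbit up to terms of degree `< j`. -/
def tangentForms (f : Module.Dual k (PS k n)) (j : ℕ) : Submodule k (Module.Dual k (PS k n)) where
  carrier := {h | h ∈ dpLT k n (j + 1) ∧ ∀ t : k, ∃ L ∈ gPlus k n,
    f ∘ₗ (L : PS k n →ₗ[k] PS k n) - f - t • h ∈ dpLT k n j}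
  zero_mem' := ⟨zero_mem _, fun t => ⟨1, one_mem _, by simp⟩⟩
  add_mem' := by
    rintro h h' ⟨hdeg, htan⟩ ⟨hdeg', htan'⟩
    refine ⟨add_mem hdeg hdeg', fun t => ?_⟩
    obtain ⟨L, hL, hLf⟩ := htan t
    obtain ⟨L', hL', hLf'⟩ := htan' t
    refine ⟨L * L', mul_mem hL hL', ?_⟩
    have hunip := isUnipotent_of_mem_gPlus hL'
    convert add_mem (add_mem (hunip.comp_mem_dpLT hLf)
      (hunip.comp_sub_mem_dpLT (Submodule.smul_mem _ t hdeg))) hLf' using 1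
    ext τ
    simp
    ring
  smul_mem' := by
    rintro c h ⟨hdeg, htan⟩
    refine ⟨Submodule.smul_mem _ c hdeg, fun t => ?_⟩
    rw [smul_smul]
    exact htan _

variable {f : Module.Dual k (PS k n)} {j : ℕ}

theorem dpLT_le_tangentForms_self : dpLT k n j ≤ tangentForms f j := fun h hh =>
  ⟨dpLT_mono j.le_succ hh, fun t => ⟨1, one_mem _, by
    convert neg_mem (Submodule.smul_mem _ t hh) using 1
    ext τ
    simp⟩⟩

theorem contract_mem_tangentForms {e : ℕ} (hf : f ∈ dpLT k n (j + 1 + e)) (he : e ≠ 0)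
    {s : PS k n} (hs : s ∈ maxIdeal k n ^ e) : contract s f ∈ tangentForms f j := by
  refine ⟨contract_mem_dpLT hf hs, fun t => ?_⟩
  obtain ⟨L, hL, h⟩ := exists_mem_gPlus_mul
    (Submodule.smul_of_tower_mem (maxIdeal k n) t (Ideal.pow_le_self he hs))
  refine ⟨L, hL, ?_⟩
  convert zero_mem (dpLT k n j)
  ext τ
  simp [h, contract_apply, add_mul, mul_comm τ s]

theorem comp_vectorField_mem_tangentForms {r : ℕ} (hr : 1 ≤ r) (hf : f ∈ dpLT k n (j + r + 1))
    {d : Fin n → PS k n} (hd : ∀ i, d i ∈ maxIdeal k n ^ (r + 1)) :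
    f ∘ₗ (vectorField d).toLinearMap ∈ tangentForms f j := by
  refine ⟨mem_dpLT.2 fun σ hσ => mem_dpLT.1 hf _ ?_, fun t => ?_⟩
  · rw [add_right_comm]
    exact vectorField_mem hd hσ
  · have htd : ∀ i, t • d i ∈ maxIdeal k n ^ (r + 1) := fun i =>
      Submodule.smul_of_tower_mem _ t (hd i)
    obtain ⟨φ, hφX, hφ⟩ := exists_algEquiv_X_add (d := fun i => t • d i)
      fun i => Ideal.pow_le_pow_right (by lia) (htd i)
    refine ⟨_, hφ, mem_dpLT.2 fun σ hσ => ?_⟩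
    have hscale : vectorField (fun i => t • d i) σ = t • vectorField d σ := by
      simp only [vectorField_apply, smul_mul_assoc, Finset.smul_sum]
    have := mem_dpLT.1 hf _ (Ideal.pow_le_pow_right (by lia)
      (algHom_sub_self_sub_vectorField_mem (φ := φ.toAlgHom) htd hφX hσ))
    rw [hscale, map_sub, map_sub, map_smul] at this
    exact this

theorem gPlusOrbit_eq_of_dpLT_le_tangentForms {e : ℕ} (hf : f ∈ dpLT k n (e + 1))
    (htan : ∀ j < e, dpLT k n (j + 1) ≤ tangentForms f j) :
    gPlusOrbit f = {g | g - f ∈ dpLT k n e} := by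
  refine Set.Subset.antisymm ?_ fun g hg => ?_
  · rintro _ ⟨L, hL, rfl⟩
    exact (isUnipotent_of_mem_gPlus hL).comp_sub_mem_dpLT hf
  suffices ∀ j ≤ e, ∀ g, g - f ∈ dpLT k n j → g ∈ gPlusOrbit f from this e le_rfl g hg
  clear hg g
  intro j
  induction j with
  | zero =>
    intro _ g hg
    refine ⟨1, one_mem _, sub_eq_zero.1 (LinearMap.ext fun τ => ?_)⟩
    exact mem_dpLT.1 hg τ (by simp)
  | succ j ih =>
    intro hj g hg
    obtain ⟨L, hL, hLf⟩ := (htan j hj hg).2 1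
    have hinv := isUnipotent_of_mem_gPlus (inv_mem hL)
    have hcomp : g ∘ₗ ((L⁻¹ : PS k n ≃ₗ[k] PS k n) : PS k n →ₗ[k] PS k n) - f ∈ dpLT k n j := by
      convert neg_mem (hinv.comp_mem_dpLT hLf) using 1
      ext τ
      simp
    obtain ⟨L', hL', hLg⟩ := ih (by lia) _ hcomp
    refine ⟨L' * L, mul_mem hL' hL, LinearMap.ext fun τ => ?_⟩
    have hcancel : L⁻¹ (L τ) = τ := L.symm_apply_apply τ
    simpa [hcancel] using LinearMap.congr_fun hLg (L τ)

end Orbit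

section MaximalMinors

open Matrix

variable {R : Type*} [CommRing R] {m : ℕ}

/-- The signed maximal minors of an `m × (m + 1)` matrix, that is, the cofactors of a further
first row. -/
def maximalMinors (M : Matrix (Fin m) (Fin (m + 1)) R) : Fin (m + 1) → R := fun j =>
  (-1) ^ (j : ℕ) * (M.submatrix id j.succAbove).det

theorem dotProduct_maximalMinors (r : Fin (m + 1) → R) (M : Matrix (Fin m) (Fin (m + 1)) R) :
    r ⬝ᵥ maximalMinors M = (of (Fin.cons r M)).det := by
  rw [det_succ_row_zero, dotProduct]
  refine Finset.sum_congr rfl fun j _ => ?_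
  rw [maximalMinors, mul_left_comm, mul_assoc]
  rfl

theorem mulVec_maximalMinors (M : Matrix (Fin m) (Fin (m + 1)) R) : M *ᵥ maximalMinors M = 0 := by
  ext i
  rw [mulVec, dotProduct_maximalMinors]
  exact det_zero_of_row_eq (Fin.succ_ne_zero i).symm rfl

theorem map_maximalMinors {R' : Type*} [CommRing R'] (φ : R →+* R')
    (M : Matrix (Fin m) (Fin (m + 1)) R) : φ ∘ maximalMinors M = maximalMinors (M.map φ) := by
  ext j
  simp only [Function.comp_apply, maximalMinors, map_mul, map_pow, map_neg, map_one,
    RingHom.map_det]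
  rfl

variable {k : Type*} [Field k] {M : Matrix (Fin m) (Fin (m + 1)) k}

theorem maximalMinors_ne_zero_iff : maximalMinors M ≠ 0 ↔ LinearIndependent k M.row := by
  constructor
  · intro h
    obtain ⟨j, hj⟩ := Function.ne_iff.1 h
    rw [← single_one_dotProduct j (maximalMinors M), dotProduct_maximalMinors] at hj
    exact (linearIndependent_rows_of_det_ne_zero hj).comp Fin.succ (Fin.succ_injective m)
  · intro h h0
    obtain ⟨r, hr⟩ : ∃ r, r ∉ Submodule.span k (Set.range M.row) := by
      by_contra! htop
      have hfin := finrank_span_eq_card h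
      rw [(Submodule.eq_top_iff').2 htop, finrank_top, Module.finrank_fin_fun,
        Fintype.card_fin] at hfin
      lia
    have hdet : (of (Fin.cons r M)).det = 0 := by
      rw [← dotProduct_maximalMinors, h0, dotProduct_zero]
    have hcons : LinearIndependent k (of (Fin.cons r M)).row := linearIndependent_finCons.2 ⟨h, hr⟩
    rw [linearIndependent_rows_iff_isUnit, isUnit_iff_isUnit_det, hdet] at hcons
    exact not_isUnit_zero hcons

theorem mulVec_eq_zero_iff_exists_smul_maximalMinors (hM : LinearIndependent k M.row)
    {c : Fin (m + 1) → k} : M *ᵥ c = 0 ↔ ∃ t : k, c = t • maximalMinors M := by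
  refine ⟨fun hc => ?_, ?_⟩
  · have hker : Module.finrank k (LinearMap.ker M.mulVecLin) = 1 := by
      have := M.mulVecLin.finrank_range_add_finrank_ker
      have hrank : M.rank = _ := hM.rank_matrix
      rw [Matrix.rank] at hrank
      rw [hrank, Fintype.card_fin, Module.finrank_fin_fun] at this
      lia
    have hne : (⟨maximalMinors M, mulVec_maximalMinors M⟩ : LinearMap.ker M.mulVecLin) ≠ 0 :=
      fun h => maximalMinors_ne_zero_iff.2 hM (congrArg Subtype.val h)
    obtain ⟨t, ht⟩ := (finrank_eq_one_iff_of_nonzero' _ hne).1 hker ⟨c, hc⟩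
    exact ⟨t, (congrArg Subtype.val ht).symm⟩
  · rintro ⟨t, rfl⟩
    rw [mulVec_smul, mulVec_maximalMinors, smul_zero]

end MaximalMinors

section CubicForms

open Matrix

/-- The Hankel matrix `w (i + j)` with `m` rows and `n` columns. -/
def hankel {R : Type*} (m n : ℕ) (w : ℕ → R) : Matrix (Fin m) (Fin n) R := of fun i j => w (i + j)

theorem hankel_transpose {R : Type*} (m n : ℕ) (w : ℕ → R) : (hankel m n w)ᵀ = hankel n m w := by
  ext i j
  simp [hankel, add_comm]

variable {R : Type*} [CommRing R]

/-- The coefficients of `x³, x²y, xy², y³` in the cubic form apolar to the quintic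
`∑ w l x^[5-l] y^[l]`. -/
def apolarCubic (w : ℕ → R) : Fin 4 → R := maximalMinors (hankel 3 4 w)

theorem map_apolarCubic {R' : Type*} [CommRing R'] (φ : R →+* R') (w : ℕ → R) :
    φ ∘ apolarCubic w = apolarCubic (φ ∘ w) :=
  map_maximalMinors φ _

/-- The coefficients of the Hessian covariant of `c 0 x³ + c 1 x²y + c 2 xy² + c 3 y³`, up to a
scalar: the minors of the coefficient matrix of the two partial derivatives. -/
def hessian (c : Fin 4 → R) : Fin 3 → R :=
  ![c 1 ^ 2 - 3 * c 0 * c 2, c 1 * c 2 - 9 * c 0 * c 3, c 2 ^ 2 - 3 * c 1 * c 3]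

theorem map_hessian {R' : Type*} [CommRing R'] (φ : R →+* R') (c : Fin 4 → R) :
    φ ∘ hessian c = hessian (φ ∘ c) := by
  ext i
  fin_cases i <;> simp [hessian, map_ofNat φ]

theorem hessian_zero : hessian (0 : Fin 4 → R) = 0 := by
  ext i
  fin_cases i <;> simp [hessian]

theorem hessian_smul (t : R) (c : Fin 4 → R) : hessian (t • c) = t ^ 2 • hessian c := by
  ext i
  fin_cases i <;> simp [hessian] <;> ring

/-- The coefficients of `(u x + v y)³`. -/
def cubeCoeff (u v : R) : Fin 4 → R := ![u ^ 3, 3 * u ^ 2 * v, 3 * u * v ^ 2, v ^ 3]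

theorem hessian_cubeCoeff (u v : R) : hessian (cubeCoeff u v) = 0 := by
  ext i
  fin_cases i <;> simp [hessian, cubeCoeff] <;> ring

variable {k : Type*} [Field k]

theorem eq_zero_of_hessian_ne_zero {c : Fin 4 → k} (hc : hessian c ≠ 0) {a b : k}
    (h₁ : a * c 1 = 3 * b * c 0) (h₂ : a * c 2 = b * c 1) (h₃ : 3 * a * c 3 = b * c 2) :
    a = 0 ∧ b = 0 := by
  obtain ⟨i, hi⟩ := Function.ne_iff.1 hc
  have ha : a * hessian c i = 0 := by
    fin_cases i <;> dsimp [hessian]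
    · linear_combination c 1 * h₁ - 3 * c 0 * h₂
    · linear_combination c 2 * h₁ - 3 * c 0 * h₃
    · linear_combination c 2 * h₂ - c 1 * h₃
  have hb : b * hessian c i = 0 := by
    fin_cases i <;> dsimp [hessian]
    · linear_combination c 2 * h₁ - c 1 * h₂
    · linear_combination 3 * c 3 * h₁ - c 1 * h₃
    · linear_combination 3 * c 3 * h₂ - c 2 * h₃
  exact ⟨(mul_eq_zero.1 ha).resolve_right hi, (mul_eq_zero.1 hb).resolve_right hi⟩

theorem exists_eq_cubeCoeff (h3 : (3 : k) ≠ 0) (hcube : ∀ a : k, ∃ b, b ^ 3 = a) {c : Fin 4 → k}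
    (hc : hessian c = 0) : ∃ u v, c = cubeCoeff u v := by
  have h₀ : c 1 ^ 2 - 3 * c 0 * c 2 = 0 := congrFun hc 0
  have h₁ : c 1 * c 2 - 9 * c 0 * c 3 = 0 := congrFun hc 1
  have h₂ : c 2 ^ 2 - 3 * c 1 * c 3 = 0 := congrFun hc 2
  obtain ⟨u, hu⟩ := hcube (c 0)
  rcases eq_or_ne u 0 with rfl | hu0
  · have hc0 : c 0 = 0 := by simpa using hu.symm
    have hc1 : c 1 = 0 := by simpa [hc0] using h₀
    have hc2 : c 2 = 0 := by simpa [hc1] using h₂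
    obtain ⟨v, hv⟩ := hcube (c 3)
    refine ⟨0, v, ?_⟩
    ext i
    fin_cases i <;> simp [cubeCoeff, hc0, hc1, hc2, hv]
  · have h3u : 3 * u ^ 2 ≠ 0 := by positivity
    obtain ⟨v, hv⟩ : ∃ v, c 1 = 3 * u ^ 2 * v := ⟨c 1 / (3 * u ^ 2), (mul_div_cancel₀ _ h3u).symm⟩
    rw [← hu, hv] at h₀ h₁
    have hc2 : c 2 = 3 * u * v ^ 2 :=
      mul_left_cancel₀ (mul_ne_zero h3u hu0) (by linear_combination -h₀)
    rw [hc2] at h₁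
    have hc3 : c 3 = v ^ 3 :=
      mul_left_cancel₀ (mul_ne_zero (mul_ne_zero h3u hu0) h3) (by linear_combination -h₁)
    refine ⟨u, v, ?_⟩
    ext i
    fin_cases i <;> simp [cubeCoeff, hu, hv, hc2, hc3]

end CubicForms

section HomogeneousParts

variable {k : Type*} [Field k] {n : ℕ}

theorem homogeneousComponent_eq_zero {d : ℕ} {σ : PS k n} (hσ : σ ∈ maxIdeal k n ^ (d + 1)) :
    homogeneousComponent d σ = 0 := by
  ext a
  rw [coeff_homogeneousComponent]
  split_ifs with h
  · rw [mem_maxIdeal_pow_iff.1 hσ a (by lia), map_zero]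
  · rw [map_zero]

theorem homPart_mem_dpLT (d : ℕ) (f : Module.Dual k (PS k n)) : homPart d f ∈ dpLT k n (d + 1) :=
  mem_dpLT.2 fun σ hσ => by rw [homPart_apply, homogeneousComponent_eq_zero hσ, map_zero]

theorem homPart_apply_of_mem {d : ℕ} {f : Module.Dual k (PS k n)} (hf : f ∈ dpLT k n (d + 1))
    {σ : PS k n} (hσ : σ ∈ maxIdeal k n ^ d) : homPart d f σ = f σ := by
  rw [homPart_apply, eq_comm, ← sub_eq_zero, ← map_sub]
  exact mem_dpLT.1 hf _ (sub_homogeneousComponent_mem hσ)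

theorem sub_homPart_mem_dpLT {d : ℕ} {f : Module.Dual k (PS k n)} (hf : f ∈ dpLT k n (d + 1)) :
    f - homPart d f ∈ dpLT k n d :=
  mem_dpLT.2 fun σ hσ => by rw [LinearMap.sub_apply, homPart_apply_of_mem hf hσ, sub_self]

theorem homogeneousComponent_mul_homogeneousComponent (i j : ℕ) (τ σ : PS k n) :
    homogeneousComponent (i + j) (τ * homogeneousComponent j σ) =
      homogeneousComponent (i + j) (homogeneousComponent i τ * σ) := by
  classical
  ext a
  rw [coeff_homogeneousComponent, coeff_homogeneousComponent]
  split_ifs with ha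
  · rw [coeff_mul, coeff_mul]
    refine Finset.sum_congr rfl fun x hx => ?_
    have hdeg : x.1.degree + x.2.degree = i + j := by
      rw [← ha, ← Finset.HasAntidiagonal.mem_antidiagonal.1 hx, map_add]
    rw [coeff_homogeneousComponent, coeff_homogeneousComponent]
    by_cases h : x.2.degree = j
    · rw [if_pos h, if_pos (by lia)]
    · rw [if_neg h, if_neg (by lia), mul_zero, zero_mul]
  · rfl

theorem homogeneousComponent_mem_apolarIdeal {d : ℕ} {f : Module.Dual k (PS k n)} {σ : PS k n}
    (hσ : σ ∈ apolarIdeal (homPart d f)) (j : ℕ) :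
    homogeneousComponent j σ ∈ apolarIdeal (homPart d f) := by
  refine mem_apolarIdeal.2 fun τ => ?_
  rcases le_or_gt j d with hj | hj
  · obtain ⟨i, rfl⟩ := Nat.exists_eq_add_of_le' hj
    rw [homPart_apply, homogeneousComponent_mul_homogeneousComponent]
    exact mem_apolarIdeal.1 hσ _
  · exact mem_dpLT.1 (homPart_mem_dpLT d f) _ (Ideal.mul_mem_left _ _
      (Ideal.pow_le_pow_right hj (homogeneousComponent_mem_maxIdeal_pow j σ)))

theorem mem_apolarIdeal_homPart_iff {i j : ℕ} {f : Module.Dual k (PS k n)}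
    (hf : f ∈ dpLT k n (i + j + 1)) {σ : PS k n} (hσ : homogeneousComponent j σ = σ) :
    σ ∈ apolarIdeal (homPart (i + j) f) ↔ ∀ s ∈ maxIdeal k n ^ i, f (s * σ) = 0 := by
  have hmem : ∀ s ∈ maxIdeal k n ^ i, homPart (i + j) f (s * σ) = f (s * σ) := fun s hs => by
    refine homPart_apply_of_mem hf ?_
    rw [pow_add, ← hσ]
    exact Ideal.mul_mem_mul hs (homogeneousComponent_mem_maxIdeal_pow j σ)
  refine ⟨fun h s hs => hmem s hs ▸ mem_apolarIdeal.1 h s, fun h => mem_apolarIdeal.2 fun τ => ?_⟩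
  have hτ := homogeneousComponent_mem_maxIdeal_pow i τ
  rw [← h _ hτ, ← hmem _ hτ, homPart_apply, homPart_apply,
    ← homogeneousComponent_mul_homogeneousComponent, hσ]

end HomogeneousParts

section BinaryForms

open Matrix

variable {k : Type*} [Field k]

/-- The binary form `∑ c l x^(j-l) y^l` of degree `j`. -/
noncomputable def binaryForm (j : ℕ) (c : Fin (j + 1) → k) : PS k 2 :=
  ∑ l, c l • (X 0 ^ (j - l) * X 1 ^ (l : ℕ))

/-- The coefficients of `x^(j-l) y^l` in the degree `j` part of `σ`. -/
noncomputable def formCoeff (j : ℕ) (σ : PS k 2) (l : Fin (j + 1)) : k :=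
  coeff (Finsupp.single 0 (j - l) + Finsupp.single 1 (l : ℕ)) σ

/-- The coefficients of `x^[d-l] y^[l]` in `f`. -/
noncomputable def topCoeff (d : ℕ) (f : Module.Dual k (PS k 2)) (l : ℕ) : k :=
  f (X 0 ^ (d - l) * X 1 ^ l)

theorem coeff_X_pow_mul_X_pow (a : Fin 2 →₀ ℕ) (p q : ℕ) :
    coeff a (X 0 ^ p * X 1 ^ q : PS k 2) = if a 0 = p ∧ a 1 = q then 1 else 0 := by
  classical
  rw [X_pow_eq, X_pow_eq, monomial_mul_monomial, one_mul, coeff_monomial]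
  refine if_congr ?_ rfl rfl
  simp [Finsupp.ext_iff, Fin.forall_fin_two]

theorem degree_eq_add (a : Fin 2 →₀ ℕ) : a.degree = a 0 + a 1 := by
  rw [Finsupp.degree_eq_sum, Fin.sum_univ_two]

theorem formCoeff_binaryForm (j : ℕ) (c : Fin (j + 1) → k) :
    formCoeff j (binaryForm j c) = c := by
  ext l
  rw [formCoeff, binaryForm, map_sum, Finset.sum_eq_single l]
  · simp [coeff_X_pow_mul_X_pow]
  · intro m _ hm
    have hm' : (l : ℕ) ≠ m := fun h => hm (Fin.ext h.symm)
    simp [coeff_X_pow_mul_X_pow, hm']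
  · simp

theorem homogeneousComponent_binaryForm (j : ℕ) (c : Fin (j + 1) → k) :
    homogeneousComponent j (binaryForm j c) = binaryForm j c := by
  ext a
  rw [coeff_homogeneousComponent]
  split_ifs with ha
  · rfl
  · rw [degree_eq_add] at ha
    rw [binaryForm, map_sum, eq_comm]
    refine Finset.sum_eq_zero fun l _ => ?_
    rw [map_smul, coeff_X_pow_mul_X_pow, if_neg (by lia), smul_zero]

theorem binaryForm_formCoeff (j : ℕ) (σ : PS k 2) :
    binaryForm j (formCoeff j σ) = homogeneousComponent j σ := by
  ext a
  rw [coeff_homogeneousComponent]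
  split_ifs with ha
  · rw [degree_eq_add] at ha
    have hexp : a = Finsupp.single 0 (j - a 1) + Finsupp.single 1 (a 1) := by
      simp [Finsupp.ext_iff, Fin.forall_fin_two, ← ha]
    rw [hexp]
    exact congrFun (formCoeff_binaryForm j (formCoeff j σ)) ⟨a 1, by lia⟩
  · rw [← homogeneousComponent_binaryForm, coeff_homogeneousComponent, if_neg ha]

theorem binaryForm_mem_maxIdeal_pow (j : ℕ) (c : Fin (j + 1) → k) :
    binaryForm j c ∈ maxIdeal k 2 ^ j :=
  homogeneousComponent_binaryForm j c ▸ homogeneousComponent_mem_maxIdeal_pow j _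

theorem sub_binaryForm_formCoeff_mem {j : ℕ} {σ : PS k 2} (hσ : σ ∈ maxIdeal k 2 ^ j) :
    σ - binaryForm j (formCoeff j σ) ∈ maxIdeal k 2 ^ (j + 1) := by
  rw [binaryForm_formCoeff]
  exact sub_homogeneousComponent_mem hσ

theorem formCoeff_eq_zero_iff {j : ℕ} {σ : PS k 2} (hσ : σ ∈ maxIdeal k 2 ^ j) :
    formCoeff j σ = 0 ↔ σ ∈ maxIdeal k 2 ^ (j + 1) := by
  refine ⟨fun h => ?_, fun h => funext fun l => mem_maxIdeal_pow_iff.1 h _ ?_⟩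
  · simpa [h, binaryForm] using sub_binaryForm_formCoeff_mem hσ
  · simp [degree_eq_add]
    lia

theorem formCoeff_pderiv_zero (j : ℕ) (σ : PS k 2) (l : Fin (j + 1)) :
    formCoeff j (pderiv k 0 σ) l = (j - l + 1 : ℕ) * formCoeff (j + 1) σ l.castSucc := by
  have hexp : Finsupp.single 0 (j - l) + Finsupp.single 1 (l : ℕ) + Finsupp.single 0 1 =
      (Finsupp.single 0 (j + 1 - l) + Finsupp.single 1 (l : ℕ) : Fin 2 →₀ ℕ) := by
    simp [Finsupp.ext_iff, Fin.forall_fin_two]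
    lia
  rw [formCoeff, coeff_pderiv, hexp, mul_comm]
  simp [formCoeff]

theorem formCoeff_pderiv_one (j : ℕ) (σ : PS k 2) (l : Fin (j + 1)) :
    formCoeff j (pderiv k 1 σ) l = (l + 1 : ℕ) * formCoeff (j + 1) σ l.succ := by
  rw [formCoeff, coeff_pderiv, add_assoc, ← Finsupp.single_add, mul_comm]
  simp [formCoeff]

theorem apply_binaryForm_mul_binaryForm (f : Module.Dual k (PS k 2)) {i j : ℕ}
    (b : Fin (i + 1) → k) (c : Fin (j + 1) → k) :
    f (binaryForm i b * binaryForm j c) =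
      b ⬝ᵥ hankel (i + 1) (j + 1) (topCoeff (i + j) f) *ᵥ c := by
  have hmul : ∀ (p : Fin (i + 1)) (q : Fin (j + 1)),
      f (X 0 ^ (i - p) * X 1 ^ (p : ℕ) * (X 0 ^ (j - q) * X 1 ^ (q : ℕ))) =
        topCoeff (i + j) f (p + q) := fun p q => by
    rw [topCoeff, mul_mul_mul_comm, ← pow_add, ← pow_add]
    congr 3
    lia
  rw [binaryForm, binaryForm, Finset.sum_mul_sum]
  simp only [smul_mul_smul_comm, map_sum, map_smul, hmul, dotProduct, mulVec, Finset.mul_sum,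
    hankel, of_apply, smul_eq_mul]
  refine Finset.sum_congr rfl fun p _ => Finset.sum_congr rfl fun q _ => ?_
  ring

variable {f : Module.Dual k (PS k 2)} {i j : ℕ}

theorem apply_mul_eq_dotProduct_hankel_mulVec (hf : f ∈ dpLT k 2 (i + j + 1)) {s σ : PS k 2}
    (hs : s ∈ maxIdeal k 2 ^ i) (hσ : σ ∈ maxIdeal k 2 ^ j) :
    f (s * σ) =
      formCoeff i s ⬝ᵥ hankel (i + 1) (j + 1) (topCoeff (i + j) f) *ᵥ formCoeff j σ := by
  rw [← apply_binaryForm_mul_binaryForm, ← sub_eq_zero, ← map_sub]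
  refine mem_dpLT.1 hf _ ?_
  have hsplit : s * σ - binaryForm i (formCoeff i s) * binaryForm j (formCoeff j σ) =
      s * (σ - binaryForm j (formCoeff j σ)) +
        (s - binaryForm i (formCoeff i s)) * binaryForm j (formCoeff j σ) := by ring
  rw [hsplit]
  refine Ideal.add_mem _ ?_ ?_
  · rw [add_assoc, pow_add]
    exact Ideal.mul_mem_mul hs (sub_binaryForm_formCoeff_mem hσ)
  · rw [add_right_comm, pow_add]
    exact Ideal.mul_mem_mul (sub_binaryForm_formCoeff_mem hs) (binaryForm_mem_maxIdeal_pow j _)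

theorem forall_mem_apply_mul_eq_zero_iff (hf : f ∈ dpLT k 2 (i + j + 1)) {σ : PS k 2}
    (hσ : σ ∈ maxIdeal k 2 ^ j) :
    (∀ s ∈ maxIdeal k 2 ^ i, f (s * σ) = 0) ↔
      hankel (i + 1) (j + 1) (topCoeff (i + j) f) *ᵥ formCoeff j σ = 0 := by
  refine ⟨fun h => dotProduct_eq_zero _ fun b => ?_, fun h s hs => ?_⟩
  · have hb := binaryForm_mem_maxIdeal_pow i b
    rw [dotProduct_comm, ← formCoeff_binaryForm i b,
      ← apply_mul_eq_dotProduct_hankel_mulVec hf hb hσ, h _ hb]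
  · rw [apply_mul_eq_dotProduct_hankel_mulVec hf hs hσ, h, dotProduct_zero]

theorem binaryForm_mem_apolarIdeal_homPart_iff (hf : f ∈ dpLT k 2 (i + j + 1))
    (c : Fin (j + 1) → k) :
    binaryForm j c ∈ apolarIdeal (homPart (i + j) f) ↔
      hankel (i + 1) (j + 1) (topCoeff (i + j) f) *ᵥ c = 0 := by
  rw [mem_apolarIdeal_homPart_iff hf (homogeneousComponent_binaryForm j c),
    forall_mem_apply_mul_eq_zero_iff hf (binaryForm_mem_maxIdeal_pow j c), formCoeff_binaryForm]

end BinaryForms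

section HilbertFunction

variable {k : Type*} [Field k]

section LocalAlgebra

variable {A : Type*} [CommRing A] [Algebra k A] [FiniteDimensional k A]

theorem finrank_quotient_smul_top_add (I J : Ideal A) :
    Module.finrank k (I ⧸ (J • ⊤ : Submodule A I)) + Module.finrank k (J * I : Ideal A) =
      Module.finrank k I := by
  have : FiniteDimensional k I :=
    inferInstanceAs (FiniteDimensional k (I.restrictScalars k : Submodule k A))
  have hmap : Submodule.map I.subtype (J • ⊤ : Submodule A I) = J * I := by
    rw [Submodule.map_smul'', Submodule.map_top, Submodule.range_subtype, smul_eq_mul]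
  have hequiv := ((Submodule.equivMapOfInjective I.subtype I.injective_subtype
    (J • ⊤ : Submodule A I)).restrictScalars k).finrank_eq
  rw [hmap] at hequiv
  rw [← hequiv, ← (Submodule.Quotient.restrictScalarsEquiv k (J • ⊤ : Submodule A I)).finrank_eq]
  exact Submodule.finrank_quotient_add_finrank ((J • ⊤ : Submodule A I).restrictScalars k)

theorem hasHilbertFunction_iff {H : ℕ → ℕ} :
    HasHilbertFunction k A H ↔ ∃ _ : IsLocalRing A, ∀ i,
      H i + Module.finrank k (IsLocalRing.maximalIdeal A ^ (i + 1) : Ideal A) =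
        Module.finrank k (IsLocalRing.maximalIdeal A ^ i : Ideal A) := by
  refine exists_congr fun _ => forall_congr' fun i => ?_
  rw [← finrank_quotient_smul_top_add (k := k) (IsLocalRing.maximalIdeal A ^ i)
    (IsLocalRing.maximalIdeal A), pow_succ', Nat.add_right_cancel_iff, eq_comm]

end LocalAlgebra

variable {n : ℕ}

/-- The linear map `σ ↦ σ ⌟ f`, whose kernel is the apolar ideal of `f`. -/
noncomputable def contractLin (f : Module.Dual k (PS k n)) :
    PS k n →ₗ[k] Module.Dual k (PS k n) :=
  LinearMap.compRight k f ∘ₗ (LinearMap.mul k (PS k n)).flip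

/-- The space `𝔪 ^ i ⌟ f`. -/
noncomputable def contractPow (f : Module.Dual k (PS k n)) (i : ℕ) :
    Submodule k (Module.Dual k (PS k n)) :=
  ((maxIdeal k n ^ i).restrictScalars k).map (contractLin f)

variable {f : Module.Dual k (PS k n)}

theorem contract_mem_contractPow {i : ℕ} {s : PS k n} (hs : s ∈ maxIdeal k n ^ i) :
    contract s f ∈ contractPow f i :=
  ⟨s, hs, rfl⟩

theorem contractPow_le_dpLT {d i : ℕ} (hf : f ∈ dpLT k n (d + i)) :
    contractPow f i ≤ dpLT k n d := by
  rintro _ ⟨s, hs, rfl⟩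
  exact contract_mem_dpLT hf hs

/-- The embedding of `Apolar f` into the functionals that is induced by `σ ↦ σ ⌟ f`. -/
noncomputable def apolarEmbedding (f : Module.Dual k (PS k n)) :
    Apolar f →ₗ[k] Module.Dual k (PS k n) :=
  (((apolarIdeal f).restrictScalars k).liftQ (contractLin f) fun _ h => h) ∘ₗ
    (Submodule.Quotient.restrictScalarsEquiv k (apolarIdeal f)).symm.toLinearMap

theorem apolarEmbedding_injective (f : Module.Dual k (PS k n)) :
    Function.Injective (apolarEmbedding f) := by
  rw [injective_iff_map_eq_zero]
  intro a ha
  obtain ⟨σ, rfl⟩ := Ideal.Quotient.mk_surjective a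
  exact Ideal.Quotient.eq_zero_iff_mem.2 ha

theorem finiteDimensional_apolar {d : ℕ} (hf : f ∈ dpLT k n d) :
    FiniteDimensional k (Apolar f) := by
  have hrange : LinearMap.range (apolarEmbedding f) ≤ dpLT k n d := by
    rintro _ ⟨a, rfl⟩
    obtain ⟨σ, rfl⟩ := Ideal.Quotient.mk_surjective a
    exact contract_mem_dpLT (e := 0) hf (by simp)
  have := Submodule.finiteDimensional_of_le hrange
  exact Module.Finite.equiv (LinearEquiv.ofInjective _ (apolarEmbedding_injective f)).symm

theorem maximalIdeal_apolar_pow (f : Module.Dual k (PS k n)) [IsLocalRing (Apolar f)] (i : ℕ) :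
    IsLocalRing.maximalIdeal (Apolar f) ^ i =
      (maxIdeal k n ^ i).map (Ideal.Quotient.mk (apolarIdeal f)) := by
  rw [Ideal.map_pow, IsLocalRing.map_maximalIdeal_of_surjective _ Ideal.Quotient.mk_surjective]

theorem finrank_maximalIdeal_apolar_pow (f : Module.Dual k (PS k n)) [IsLocalRing (Apolar f)]
    (i : ℕ) : Module.finrank k (IsLocalRing.maximalIdeal (Apolar f) ^ i : Ideal (Apolar f)) =
      Module.finrank k (contractPow f i) := by
  have hmap : ((IsLocalRing.maximalIdeal (Apolar f) ^ i).restrictScalars k).map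
      (apolarEmbedding f) = contractPow f i := by
    rw [maximalIdeal_apolar_pow]
    apply le_antisymm
    · rintro _ ⟨a, ha, rfl⟩
      obtain ⟨σ, hσ, rfl⟩ := (Ideal.mem_map_iff_of_surjective _ Ideal.Quotient.mk_surjective).1 ha
      exact ⟨σ, hσ, rfl⟩
    · rintro _ ⟨σ, hσ, rfl⟩
      exact ⟨_, Ideal.mem_map_of_mem _ hσ, rfl⟩
  rw [← hmap]
  exact (Submodule.equivMapOfInjective (apolarEmbedding f) (apolarEmbedding_injective f)
    ((IsLocalRing.maximalIdeal (Apolar f) ^ i).restrictScalars k)).finrank_eq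

theorem hasHilbertFunction_apolar_iff {d : ℕ} (hf : f ∈ dpLT k n d) {H : ℕ → ℕ} :
    HasHilbertFunction k (Apolar f) H ↔ IsLocalRing (Apolar f) ∧
      ∀ i, H i + Module.finrank k (contractPow f (i + 1)) =
        Module.finrank k (contractPow f i) := by
  have := finiteDimensional_apolar hf
  rw [hasHilbertFunction_iff, ← exists_prop]
  refine exists_congr fun _ => forall_congr' fun i => ?_
  rw [← finrank_maximalIdeal_apolar_pow, ← finrank_maximalIdeal_apolar_pow]

theorem finrank_quotient_maxIdeal_pow (e : ℕ) :
    Module.finrank k (PS k n ⧸ maxIdeal k n ^ e) = Module.finrank k (dpLT k n e) := by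
  rw [dpLT, ← (Submodule.dualQuotEquivDualAnnihilator _).finrank_eq, Subspace.dual_finrank_eq,
    (Submodule.Quotient.restrictScalarsEquiv k (maxIdeal k n ^ e)).finrank_eq]

theorem finrank_dpLT_add_finrank_contractPow {d : ℕ} (hf : f ∈ dpLT k n d)
    [IsLocalRing (Apolar f)] {i : ℕ} (hi : apolarIdeal f ≤ maxIdeal k n ^ i) :
    Module.finrank k (dpLT k n i) + Module.finrank k (contractPow f i) =
      Module.finrank k (Apolar f) := by
  have := finiteDimensional_apolar hf
  have hquot := Submodule.finrank_quotient_add_finrank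
    (((maxIdeal k n ^ i).map (Ideal.Quotient.mk (apolarIdeal f))).restrictScalars k)
  rw [(Submodule.Quotient.restrictScalarsEquiv k _).finrank_eq] at hquot
  rw [← finrank_maximalIdeal_apolar_pow, ← finrank_quotient_maxIdeal_pow,
    ← (DoubleQuot.quotQuotEquivQuotOfLEₐ k hi).toLinearEquiv.finrank_eq, maximalIdeal_apolar_pow]
  exact hquot

theorem isLocalRing_apolar (hf : apolarIdeal f ≤ maxIdeal k n) : IsLocalRing (Apolar f) := by
  have : Nontrivial (Apolar f) := Ideal.Quotient.nontrivial_iff.2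
    (ne_top_of_le_ne_top (IsLocalRing.maximalIdeal.isMaximal (PS k n)).ne_top hf)
  exact IsLocalRing.of_surjective' _ Ideal.Quotient.mk_surjective

end HilbertFunction

section Compressed

variable {k : Type*} [Field k] {n : ℕ}

/-- `f ∈ P_{< 2e}` is compressed if only the elements of `𝔪 ^ e` annihilate `𝔪 ^ e ⌟ f`. -/
def IsCompressed (f : Module.Dual k (PS k n)) (e : ℕ) : Prop :=
  ∀ σ, (∀ s ∈ maxIdeal k n ^ e, f (s * σ) = 0) → σ ∈ maxIdeal k n ^ e

/-- The largest possible Hilbert function of `Apolar f` for `f ∈ P_{< 2e}` in `n` variables: the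
number of monomials of degree `i` or `2e - 1 - i`, whichever is smaller. -/
def compressedHilbertFunction (n e i : ℕ) : ℕ :=
  if i < 2 * e then (n + min i (2 * e - 1 - i) - 1).choose (min i (2 * e - 1 - i)) else 0

theorem h123321_eq : h123321 = compressedHilbertFunction 2 3 := by
  ext i
  by_cases hi : i < 6
  · interval_cases i <;> rfl
  · rw [compressedHilbertFunction, if_neg hi, h123321, List.getD_eq_default _ _ (not_lt.1 hi)]

theorem compressedHilbertFunction_add_finrank_of_lt {e i : ℕ} (hi : i < e) :
    compressedHilbertFunction n e i + Module.finrank k (dpLT k n i) =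
      Module.finrank k (dpLT k n (i + 1)) := by
  rw [compressedHilbertFunction, if_pos (by lia), min_eq_left (by lia), finrank_dpLT, finrank_dpLT,
    Finset.sum_range_succ, add_comm]

theorem compressedHilbertFunction_add_finrank_of_add_eq {e m j : ℕ} (hm : m + (j + 1) = e) :
    compressedHilbertFunction n e (e + m) + Module.finrank k (dpLT k n j) =
      Module.finrank k (dpLT k n (j + 1)) := by
  rw [compressedHilbertFunction, if_pos (by lia), min_eq_right (by lia), finrank_dpLT,
    finrank_dpLT, Finset.sum_range_succ, add_comm, show 2 * e - 1 - (e + m) = j by lia]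

variable {f : Module.Dual k (PS k n)} {e : ℕ}

theorem isCompressed_iff_contractPow_eq (hf : f ∈ dpLT k n (e + e)) :
    IsCompressed f e ↔ contractPow f e = dpLT k n e := by
  have hle := contractPow_le_dpLT hf
  have := Submodule.finiteDimensional_of_le hle
  refine ⟨fun h => le_antisymm hle (dpLT_le_of_forall_mem fun σ hσ => h σ fun s hs => ?_),
    fun h σ hσ => forall_mem_dpLT_apply_eq_zero_iff.1 (h ▸ ?_)⟩
  · rw [mul_comm]
    exact hσ _ (contract_mem_contractPow hs)
  · rintro _ ⟨s, hs, rfl⟩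
    exact (congrArg f (mul_comm σ s)).trans (hσ s hs)

namespace IsCompressed

theorem apolarIdeal_le (h : IsCompressed f e) : apolarIdeal f ≤ maxIdeal k n ^ e := fun _ hσ =>
  h _ fun s _ => mem_apolarIdeal.1 hσ s

theorem mem_maxIdeal_pow [NeZero n] (h : IsCompressed f e) {m j : ℕ} (hm : m + j = e) {σ : PS k n}
    (hσ : ∀ s ∈ maxIdeal k n ^ (e + m), f (s * σ) = 0) : σ ∈ maxIdeal k n ^ j := by
  refine mem_maxIdeal_pow_of_X_pow_mul_mem (i := 0) (m := m) (hm ▸ h _ fun s hs => ?_)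
  rw [← mul_assoc]
  refine hσ _ ?_
  rw [pow_add]
  exact Ideal.mul_mem_mul hs (Ideal.pow_mem_pow (X_mem_maxIdeal 0) m)

theorem contractPow_eq [NeZero n] (hf : f ∈ dpLT k n (e + e)) (h : IsCompressed f e) {m j : ℕ}
    (hm : m + j = e) : contractPow f (e + m) = dpLT k n j := by
  have hle : contractPow f (e + m) ≤ dpLT k n j :=
    contractPow_le_dpLT (by rwa [add_left_comm, add_comm j, hm])
  have := Submodule.finiteDimensional_of_le hle
  refine le_antisymm hle (dpLT_le_of_forall_mem fun σ hσ => h.mem_maxIdeal_pow hm fun s hs => ?_)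
  rw [mul_comm]
  exact hσ _ (contract_mem_contractPow hs)

end IsCompressed

theorem contractPow_eq_bot {d i : ℕ} (hf : f ∈ dpLT k n d) (hi : d ≤ i) : contractPow f i = ⊥ := by
  have hle : contractPow f i ≤ dpLT k n 0 := contractPow_le_dpLT (dpLT_mono (by lia) hf)
  refine eq_bot_iff.2 (hle.trans fun g hg => (Submodule.mem_bot k).2 (LinearMap.ext fun τ => ?_))
  exact mem_dpLT.1 hg τ (by simp)

theorem hasHilbertFunction_compressed_iff [NeZero n] (he : e ≠ 0) (hf : f ∈ dpLT k n (e + e)) :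
    HasHilbertFunction k (Apolar f) (compressedHilbertFunction n e) ↔ IsCompressed f e := by
  rw [hasHilbertFunction_apolar_iff hf]
  have hzero : ∀ i, e + e ≤ i → Module.finrank k (contractPow f i) = 0 := fun i hi => by
    rw [contractPow_eq_bot hf hi, finrank_bot]
  constructor
  · rintro ⟨-, hH⟩
    have hfinrank : ∀ j m, m + j = e →
        Module.finrank k (contractPow f (e + m)) = Module.finrank k (dpLT k n j) := by
      intro j
      induction j with
      | zero =>
        intro m hm
        rw [hzero _ (by lia), finrank_dpLT, Finset.sum_range_zero]
      | succ j ih =>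
        intro m hm
        rw [← hH, ← compressedHilbertFunction_add_finrank_of_add_eq hm, add_assoc e m 1,
          ih (m + 1) (by lia)]
    exact (isCompressed_iff_contractPow_eq hf).2 (Submodule.eq_of_le_of_finrank_eq
      (contractPow_le_dpLT hf) (hfinrank e 0 (zero_add e)))
  · intro h
    have hloc := isLocalRing_apolar (h.apolarIdeal_le.trans (Ideal.pow_le_self he))
    have hsmall : ∀ i ≤ e, Module.finrank k (dpLT k n i) + Module.finrank k (contractPow f i) =
        Module.finrank k (Apolar f) := fun i hi =>
      finrank_dpLT_add_finrank_contractPow hf (h.apolarIdeal_le.trans (Ideal.pow_le_pow_right hi))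
    refine ⟨hloc, fun i => ?_⟩
    rcases lt_or_ge i e with hi | hi
    · have hdim := compressedHilbertFunction_add_finrank_of_lt (k := k) (n := n) hi
      have := hsmall i hi.le
      have := hsmall (i + 1) hi
      lia
    · obtain ⟨m, rfl⟩ := Nat.exists_eq_add_of_le hi
      rcases lt_or_ge m e with hm | hm
      · obtain ⟨j, hj⟩ := Nat.exists_eq_add_of_lt hm
        rw [add_assoc e m 1, h.contractPow_eq hf (m := m) (j := j + 1) (by lia),
          h.contractPow_eq hf (m := m + 1) (j := j) (by lia)]
        exact compressedHilbertFunction_add_finrank_of_add_eq (by lia)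
      · rw [hzero _ (by lia), hzero _ (by lia), compressedHilbertFunction, if_neg (by lia)]

theorem isCompressed_iff_linearIndependent_hankel {j : ℕ} {f : Module.Dual k (PS k 2)}
    (hf : f ∈ dpLT k 2 (j + 1 + j + 1)) : IsCompressed f (j + 1) ↔
      LinearIndependent k (hankel (j + 1) (j + 1 + 1) (topCoeff (j + 1 + j) f)).row := by
  rw [← hankel_transpose, Matrix.row_transpose, ← Matrix.mulVec_injective_iff,
    ← Matrix.coe_mulVecLin, injective_iff_map_eq_zero]
  constructor
  · intro h c hc
    have hmem := binaryForm_mem_maxIdeal_pow j c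
    rw [← formCoeff_binaryForm j c, formCoeff_eq_zero_iff hmem]
    refine h _ ((forall_mem_apply_mul_eq_zero_iff hf hmem).2 ?_)
    rwa [formCoeff_binaryForm]
  · intro h σ hσ
    suffices ∀ i ≤ j + 1, σ ∈ maxIdeal k 2 ^ i from this _ le_rfl
    intro i
    induction i with
    | zero => simp
    | succ i ih =>
      intro hi
      obtain ⟨m, rfl⟩ := Nat.exists_eq_add_of_le' (Nat.le_of_succ_le_succ hi)
      have hmem : X 0 ^ m * σ ∈ maxIdeal k 2 ^ (m + i) := by
        rw [pow_add]
        exact Ideal.mul_mem_mul (Ideal.pow_mem_pow (X_mem_maxIdeal 0) m) (ih (by lia))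
      refine mem_maxIdeal_pow_of_X_pow_mul_mem (i := 0) (m := m) ((formCoeff_eq_zero_iff hmem).1
        (h _ ((forall_mem_apply_mul_eq_zero_iff hf hmem).1 fun s hs => ?_)))
      rw [← mul_assoc]
      exact hσ _ (Ideal.mul_mem_right _ _ hs)

end Compressed

section TangentSpace

open Matrix

variable {k : Type*} [Field k] {n : ℕ} {f : Module.Dual k (PS k n)} {e j : ℕ}

theorem dpLT_succ_le_tangentForms
    (h : ∀ σ ∈ maxIdeal k n ^ j, (∀ g ∈ tangentForms f j, g σ = 0) → σ ∈ maxIdeal k n ^ (j + 1)) :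
    dpLT k n (j + 1) ≤ tangentForms f j := by
  have hle : tangentForms f j ≤ dpLT k n (j + 1) := fun _ hg => hg.1
  have := Submodule.finiteDimensional_of_le hle
  exact dpLT_le_of_forall_mem fun σ hσ => h σ
    (forall_mem_dpLT_apply_eq_zero_iff.1 fun g hg => hσ g (dpLT_le_tangentForms_self hg)) hσ

theorem apply_mul_pderiv_eq_zero {r : ℕ} (hr : 1 ≤ r) (hf : f ∈ dpLT k n (j + r + 1)) {σ : PS k n}
    (hσ : ∀ g ∈ tangentForms f j, g σ = 0) (i : Fin n) {s : PS k n}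
    (hs : s ∈ maxIdeal k n ^ (r + 1)) : f (s * pderiv k i σ) = 0 := by
  have hd : ∀ l, (Pi.single i s : Fin n → PS k n) l ∈ maxIdeal k n ^ (r + 1) := fun l => by
    rcases eq_or_ne l i with rfl | hl
    · rwa [Pi.single_eq_same]
    · rw [Pi.single_eq_of_ne hl]
      exact zero_mem _
  have := hσ _ (comp_vectorField_mem_tangentForms hr hf hd)
  rwa [LinearMap.comp_apply, Derivation.coeFn_coe, vectorField_apply,
    Finset.sum_eq_single_of_mem i (Finset.mem_univ i)
      fun l _ hl => by rw [Pi.single_eq_of_ne hl, zero_mul], Pi.single_eq_same] at this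

namespace IsCompressed

theorem dpLT_le_tangentForms_of_lt [NeZero n] (h : IsCompressed f e) (hf : f ∈ dpLT k n (e + e))
    (hj : j < e) : dpLT k n (j + 1) ≤ tangentForms f j := by
  obtain ⟨m, rfl⟩ := Nat.exists_eq_add_of_lt hj
  refine dpLT_succ_le_tangentForms fun σ _ hσ => h.mem_maxIdeal_pow (m := m) (by lia)
    fun s hs => ?_
  rw [mul_comm]
  exact hσ _ (contract_mem_tangentForms (by convert hf using 1; lia) (by lia) hs)

theorem dpLT_le_tangentForms_self (h : IsCompressed f e) (hf : f ∈ dpLT k n (e + e))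
    (he : 2 ≤ e) (hek : (e : k) ≠ 0) : dpLT k n (e + 1) ≤ tangentForms f e := by
  obtain ⟨r, rfl⟩ := Nat.exists_eq_add_of_le' (Nat.one_le_of_lt he)
  exact dpLT_succ_le_tangentForms fun σ hσ horth =>
    mem_maxIdeal_pow_succ_of_forall_pderiv_mem hek hσ fun i =>
      h _ fun s hs => apply_mul_pderiv_eq_zero (by lia) hf horth i hs

end IsCompressed

theorem eq_zero_of_formCoeff_pderiv_eq_smul {c : Fin 4 → k} (hc : hessian c ≠ 0) {σ : PS k 2}
    {a b : k} (ha : formCoeff 3 (pderiv k 0 σ) = a • c)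
    (hb : formCoeff 3 (pderiv k 1 σ) = b • c) : a = 0 ∧ b = 0 := by
  have h₀ : ∀ l : Fin 4, a * c l = (3 - l + 1 : ℕ) * formCoeff 4 σ l.castSucc := fun l => by
    rw [← formCoeff_pderiv_zero, ha, Pi.smul_apply, smul_eq_mul]
  have h₁ : ∀ l : Fin 4, b * c l = (l + 1 : ℕ) * formCoeff 4 σ l.succ := fun l => by
    rw [← formCoeff_pderiv_one, hb, Pi.smul_apply, smul_eq_mul]
  have h₀1 : a * c 1 = (3 : ℕ) * formCoeff 4 σ 1 := h₀ 1
  have h₀2 : a * c 2 = (2 : ℕ) * formCoeff 4 σ 2 := h₀ 2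
  have h₀3 : a * c 3 = (1 : ℕ) * formCoeff 4 σ 3 := h₀ 3
  have h₁0 : b * c 0 = (1 : ℕ) * formCoeff 4 σ 1 := h₁ 0
  have h₁1 : b * c 1 = (2 : ℕ) * formCoeff 4 σ 2 := h₁ 1
  have h₁2 : b * c 2 = (3 : ℕ) * formCoeff 4 σ 3 := h₁ 2
  push_cast at h₀1 h₀2 h₀3 h₁0 h₁1 h₁2
  refine eq_zero_of_hessian_ne_zero hc ?_ ?_ ?_
  · linear_combination h₀1 - 3 * h₁0
  · linear_combination h₀2 - h₁1
  · linear_combination 3 * h₀3 - h₁2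

variable {f : Module.Dual k (PS k 2)}

theorem isCompressed_three_iff (hf : f ∈ dpLT k 2 6) :
    IsCompressed f 3 ↔ LinearIndependent k (hankel 3 4 (topCoeff 5 f)).row :=
  isCompressed_iff_linearIndependent_hankel hf

theorem isCompressed_of_hessian_ne_zero (hf : f ∈ dpLT k 2 6)
    (hess : hessian (apolarCubic (topCoeff 5 f)) ≠ 0) : IsCompressed f 3 := by
  rw [isCompressed_three_iff hf, ← maximalMinors_ne_zero_iff]
  intro h
  exact hess (by rw [apolarCubic, h, hessian_zero])

theorem dpLT_five_le_tangentForms (h4 : (4 : k) ≠ 0) (hf : f ∈ dpLT k 2 6)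
    (hess : hessian (apolarCubic (topCoeff 5 f)) ≠ 0) : dpLT k 2 5 ≤ tangentForms f 4 := by
  have hcomp := isCompressed_of_hessian_ne_zero hf hess
  refine dpLT_succ_le_tangentForms fun σ hσ horth =>
    mem_maxIdeal_pow_succ_of_forall_pderiv_mem (by exact_mod_cast h4) hσ ?_
  have hmem : ∀ i, pderiv k i σ ∈ maxIdeal k 2 ^ 3 := pderiv_mem_maxIdeal_pow hσ
  have hproportional : ∀ i, ∃ t, formCoeff 3 (pderiv k i σ) = t • apolarCubic (topCoeff 5 f) :=
    fun i => (mulVec_eq_zero_iff_exists_smul_maximalMinors ((isCompressed_three_iff hf).1 hcomp)).1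
      ((forall_mem_apply_mul_eq_zero_iff (i := 2) (j := 3) hf (hmem i)).1 fun _ =>
        apply_mul_pderiv_eq_zero (r := 1) le_rfl hf horth i)
  obtain ⟨a, ha⟩ := hproportional 0
  obtain ⟨b, hb⟩ := hproportional 1
  obtain ⟨rfl, rfl⟩ := eq_zero_of_formCoeff_pderiv_eq_smul hess ha hb
  refine Fin.forall_fin_two.2 ⟨?_, ?_⟩
  · rw [← formCoeff_eq_zero_iff (hmem 0), ha, zero_smul]
  · rw [← formCoeff_eq_zero_iff (hmem 1), hb, zero_smul]

theorem gPlusOrbit_eq_of_hessian_ne_zero (h2 : (2 : k) ≠ 0) (h3 : (3 : k) ≠ 0)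
    (hf : f ∈ dpLT k 2 6) (hess : hessian (apolarCubic (topCoeff 5 f)) ≠ 0) :
    gPlusOrbit f = {g | g - f ∈ dpLT k 2 5} := by
  have hcomp := isCompressed_of_hessian_ne_zero hf hess
  refine gPlusOrbit_eq_of_dpLT_le_tangentForms hf fun j hj => ?_
  obtain hj | rfl | rfl : j < 3 ∨ j = 3 ∨ j = 4 := by lia
  · exact hcomp.dpLT_le_tangentForms_of_lt hf hj
  · exact hcomp.dpLT_le_tangentForms_self hf (by lia) (by exact_mod_cast h3)
  · have h4 : (4 : k) ≠ 0 := by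
      rw [show (4 : k) = 2 * 2 by norm_num]
      exact mul_ne_zero h2 h2
    exact dpLT_five_le_tangentForms h4 hf hess

end TangentSpace

section AssociatedGraded

open MvPolynomial (idealOfVars)

section ReesAlgebra

variable {A : Type*} [CommRing A] {I : Ideal A}

theorem exists_mem_map_reesAlgebra_coe_eq_monomial {i : ℕ} {a : A} (ha : a ∈ I ^ (i + 1)) :
    ∃ x ∈ I.map (algebraMap A (reesAlgebra I)), (x : Polynomial A) = Polynomial.monomial i a := by
  rw [pow_succ'] at ha
  refine Submodule.mul_induction_on ha (fun b hb c hc => ?_) ?_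
  · refine ⟨algebraMap A (reesAlgebra I) b *
      ⟨Polynomial.monomial i c, reesAlgebra.monomial_mem.2 hc⟩,
      Ideal.mul_mem_right _ _ (Ideal.mem_map_of_mem _ hb), ?_⟩
    exact Polynomial.C_mul_monomial
  · rintro b c ⟨x, hx, hxb⟩ ⟨y, hy, hyc⟩
    exact ⟨x + y, Ideal.add_mem _ hx hy, by rw [Subalgebra.coe_add, hxb, hyc, map_add]⟩

theorem mem_map_algebraMap_reesAlgebra_iff {x : reesAlgebra I} :
    x ∈ I.map (algebraMap A (reesAlgebra I)) ↔ ∀ i, (x : Polynomial A).coeff i ∈ I ^ (i + 1) := by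
  constructor
  · intro hx
    induction hx using Submodule.span_induction with
    | mem _ h =>
      obtain ⟨a, ha, rfl⟩ := h
      intro i
      change (Polynomial.C a).coeff i ∈ _
      rw [Polynomial.coeff_C]
      split_ifs with hi
      · simpa [hi] using ha
      · exact zero_mem _
    | zero => simp
    | add x y _ _ hx hy => exact fun i => by simpa using add_mem (hx i) (hy i)
    | smul r y _ hy =>
      intro i
      rw [smul_eq_mul, Subalgebra.coe_mul, Polynomial.coeff_mul]
      refine Ideal.sum_mem _ fun p hp => ?_
      rw [← Finset.HasAntidiagonal.mem_antidiagonal.1 hp, add_assoc, pow_add]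
      exact Ideal.mul_mem_mul (r.2 p.1) (hy p.2)
  · intro hx
    choose y hy hyx using fun i => exists_mem_map_reesAlgebra_coe_eq_monomial (hx i)
    have hsum : x = ∑ i ∈ (x : Polynomial A).support, y i := Subtype.ext <| by
      rw [AddSubmonoidClass.coe_finsetSum, Finset.sum_congr rfl fun i _ => hyx i]
      exact Polynomial.as_sum_support _
    rw [hsum]
    exact Ideal.sum_mem _ fun i _ => hy i

end ReesAlgebra

variable {R A ι : Type*} [CommRing R] [CommRing A] [Algebra R A] {I : Ideal A}
  {π : MvPolynomial ι R →ₐ[R] A}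

/-- The homomorphism from the polynomial ring to the Rees algebra of `I` that sends `X i` to
`π (X i) * t`. It lifts the graded homomorphism from the polynomial ring to `gr_I(A)`. -/
noncomputable def toRees (hI : ∀ i, π (.X i) ∈ I) : MvPolynomial ι R →ₐ[R] reesAlgebra I :=
  MvPolynomial.aeval fun i => ⟨Polynomial.monomial 1 (π (.X i)),
    reesAlgebra.monomial_mem.2 ((pow_one I).symm ▸ hI i)⟩

theorem toRees_monomial (hI : ∀ i, π (.X i) ∈ I) (u : ι →₀ ℕ) (a : R) :
    (toRees hI (.monomial u a) : Polynomial A) =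
      Polynomial.monomial u.degree (π (.monomial u a)) := by
  have hval : ∀ p, (toRees hI p : Polynomial A) =
      MvPolynomial.aeval (fun i => Polynomial.monomial 1 (π (.X i))) p := fun p =>
    DFunLike.congr_fun (MvPolynomial.comp_aeval _ ((reesAlgebra I).val.restrictScalars R)) p
  rw [hval, MvPolynomial.aeval_monomial, MvPolynomial.monomial_eq, map_mul, Finsupp.prod,
    Finsupp.prod, map_prod, ← MvPolynomial.algebraMap_eq, AlgHom.commutes,
    Polynomial.algebraMap_apply, ← Polynomial.C_mul_monomial]
  congr 1
  simp [← Polynomial.C_mul_X_pow_eq_monomial, mul_pow, Finset.prod_mul_distrib,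
    Finset.prod_pow_eq_pow_sum, Finsupp.degree_apply]

theorem coeff_toRees (hI : ∀ i, π (.X i) ∈ I) (p : MvPolynomial ι R) (i : ℕ) :
    (toRees hI p : Polynomial A).coeff i = π (MvPolynomial.homogeneousComponent i p) := by
  induction p using MvPolynomial.induction_on' with
  | monomial u a =>
    rw [toRees_monomial, Polynomial.coeff_monomial, MvPolynomial.homogeneousComponent_of_mem
      ((MvPolynomial.mem_homogeneousSubmodule _ _).2 (MvPolynomial.isHomogeneous_monomial a rfl))]
    simp only [eq_comm (a := i), apply_ite π, map_zero]
  | add p q hp hq => simp [hp, hq]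

theorem sub_homogeneousComponent_mem_idealOfVars {i : ℕ} {p : MvPolynomial ι R}
    (hp : p ∈ idealOfVars ι R ^ i) :
    p - MvPolynomial.homogeneousComponent i p ∈ idealOfVars ι R ^ (i + 1) := by
  rw [MvPolynomial.mem_pow_idealOfVars_iff'] at hp ⊢
  intro u hu
  rw [MvPolynomial.coeff_sub, MvPolynomial.coeff_homogeneousComponent]
  split_ifs with h
  · exact sub_self _
  · rw [hp u (by lia), sub_zero]

theorem exists_mem_idealOfVars_pow (hπ : Function.Surjective π)
    (hmap : (idealOfVars ι R).map π = I) {i : ℕ} {a : A} (ha : a ∈ I ^ i) :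
    ∃ q ∈ idealOfVars ι R ^ i, π q = a := by
  rwa [← hmap, ← Ideal.map_pow, Ideal.mem_map_iff_of_surjective _ hπ] at ha

theorem mk_comp_toRees_surjective (hI : ∀ i, π (.X i) ∈ I) (hπ : Function.Surjective π)
    (hmap : (idealOfVars ι R).map π = I) :
    Function.Surjective ((Ideal.Quotient.mkₐ R _).comp (toRees hI) :
      MvPolynomial ι R →ₐ[R] AssocGraded I) := by
  intro y
  obtain ⟨x, rfl⟩ := Ideal.Quotient.mk_surjective y
  choose q hq hqx using fun i => exists_mem_idealOfVars_pow hπ hmap (x.2 i)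
  refine ⟨∑ i ∈ (x : Polynomial A).support, MvPolynomial.homogeneousComponent i (q i), ?_⟩
  rw [AlgHom.comp_apply, Ideal.Quotient.mkₐ_eq_mk, eq_comm, Ideal.Quotient.eq,
    mem_map_algebraMap_reesAlgebra_iff]
  intro i
  have hcomp : MvPolynomial.homogeneousComponent i (∑ j ∈ (x : Polynomial A).support,
      MvPolynomial.homogeneousComponent j (q j)) = if i ∈ (x : Polynomial A).support then
        MvPolynomial.homogeneousComponent i (q i) else 0 := by
    simp only [map_sum, MvPolynomial.homogeneousComponent_of_mem
      (MvPolynomial.homogeneousComponent_mem _ _), Finset.sum_ite_eq]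
  rw [Subalgebra.coe_sub, Polynomial.coeff_sub, coeff_toRees, hcomp]
  split_ifs with hi
  · rw [← hqx, ← map_sub, ← hmap, ← Ideal.map_pow]
    exact Ideal.mem_map_of_mem π (sub_homogeneousComponent_mem_idealOfVars (hq i))
  · rw [Polynomial.notMem_support_iff.1 hi, map_zero, sub_zero]
    exact zero_mem _

theorem nonempty_algEquiv_assocGraded (hπ : Function.Surjective π)
    (hmap : (idealOfVars ι R).map π = I)
    (hker : ∀ p, π p = 0 → ∀ i, π (MvPolynomial.homogeneousComponent i p) = 0) :
    Nonempty (A ≃ₐ[R] AssocGraded I) := by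
  have hI : ∀ i, π (.X i) ∈ I := fun i =>
    hmap ▸ Ideal.mem_map_of_mem _ (Ideal.subset_span ⟨i, rfl⟩)
  have hgraded : ∀ p i, π (MvPolynomial.homogeneousComponent i p) ∈ I ^ (i + 1) →
      π (MvPolynomial.homogeneousComponent i p) = 0 := fun p i h => by
    obtain ⟨q, hq, hqp⟩ := exists_mem_idealOfVars_pow hπ hmap h
    have hqi : MvPolynomial.homogeneousComponent i q = 0 := by
      ext u
      rw [MvPolynomial.coeff_homogeneousComponent]
      split_ifs with hu
      · exact (MvPolynomial.mem_pow_idealOfVars_iff' _ _).1 hq u (by lia)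
      · rfl
    have := hker (MvPolynomial.homogeneousComponent i p - q) (by rw [map_sub, hqp, sub_self]) i
    rwa [map_sub, hqi, sub_zero, MvPolynomial.homogeneousComponent_of_mem
      (MvPolynomial.homogeneousComponent_mem _ _), if_pos rfl] at this
  have hkereq : RingHom.ker π = RingHom.ker ((Ideal.Quotient.mkₐ R _).comp (toRees hI) :
      MvPolynomial ι R →ₐ[R] AssocGraded I) := by
    ext p
    rw [RingHom.mem_ker, RingHom.mem_ker, AlgHom.comp_apply, Ideal.Quotient.mkₐ_eq_mk,
      Ideal.Quotient.eq_zero_iff_mem, mem_map_algebraMap_reesAlgebra_iff]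
    simp only [coeff_toRees]
    refine ⟨fun h i => hker p h i ▸ zero_mem _, fun h => ?_⟩
    rw [← MvPolynomial.sum_homogeneousComponent p, map_sum]
    exact Finset.sum_eq_zero fun i _ => hgraded p i (h i)
  exact ⟨(Ideal.quotientKerAlgEquivOfSurjective hπ).symm.trans
    ((Ideal.quotientEquivAlgOfEq R hkereq).trans
      (Ideal.quotientKerAlgEquivOfSurjective (mk_comp_toRees_surjective hI hπ hmap)))⟩

theorem coe_homogeneousComponent (i : ℕ) (p : MvPolynomial ι R) :
    (MvPolynomial.homogeneousComponent i p : MvPowerSeries ι R) =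
      homogeneousComponent i (p : MvPowerSeries ι R) := by
  ext a
  rw [MvPolynomial.coeff_coe, MvPolynomial.coeff_homogeneousComponent, coeff_homogeneousComponent,
    MvPolynomial.coeff_coe]

section Apolar

variable {k : Type*} [Field k] {n d : ℕ} {f : Module.Dual k (PS k n)}

theorem sub_truncTotal_mem (d : ℕ) (σ : PS k n) : σ - truncTotal d σ ∈ maxIdeal k n ^ d :=
  mem_maxIdeal_pow_iff.2 fun a ha => by
    rw [map_sub, MvPolynomial.coeff_coe, coeff_truncTotal _ ha, sub_self]

theorem isCanonicallyGraded_of_algEquiv {A : Type*} [CommRing A] [Algebra k A] [IsLocalRing A]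
    (φ : Apolar (homPart d f) ≃ₐ[k] A) : IsCanonicallyGraded k A := by
  set ρ : PS k n →ₐ[k] A := φ.toAlgHom.comp (Ideal.Quotient.mkₐ k _)
  have hρ : Function.Surjective ρ := φ.surjective.comp Ideal.Quotient.mk_surjective
  have hker : ∀ σ, ρ σ = 0 ↔ σ ∈ apolarIdeal (homPart d f) := fun σ =>
    (map_eq_zero_iff φ φ.injective).trans Ideal.Quotient.eq_zero_iff_mem
  have hmax : IsLocalRing.maximalIdeal A = (maxIdeal k n).map ρ :=
    (IsLocalRing.map_maximalIdeal_of_surjective ρ.toRingHom hρ).symm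
  have hcoe : ∀ p : MvPolynomial (Fin n) k,
      MvPolynomial.coeToMvPowerSeries.algHom k p = (p : PS k n) := fun p => by simp
  refine ⟨inferInstance, nonempty_algEquiv_assocGraded
    (π := ρ.comp (MvPolynomial.coeToMvPowerSeries.algHom k)) ?_ ?_ fun p hp i => ?_⟩
  · intro a
    obtain ⟨σ, rfl⟩ := hρ a
    refine ⟨truncTotal (d + 1) σ, ?_⟩
    rw [AlgHom.comp_apply, hcoe, eq_comm, ← sub_eq_zero, ← map_sub, hker, mem_apolarIdeal]
    exact fun τ => mem_dpLT.1 (homPart_mem_dpLT d f) _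
      (Ideal.mul_mem_left _ _ (sub_truncTotal_mem (d + 1) σ))
  · rw [hmax, maxIdeal_eq_span, idealOfVars, Ideal.map_span, Ideal.map_span, ← Set.range_comp,
      ← Set.range_comp]
    congr 2
    ext i
    simp
  · rw [AlgHom.comp_apply, hcoe, hker] at hp ⊢
    rw [coe_homogeneousComponent]
    exact homogeneousComponent_mem_apolarIdeal hp i

end Apolar

end AssociatedGraded

section CubicNotPower

open Matrix

variable {k : Type*} [Field k]

theorem sum_smul_X_pow_three (v : Fin 2 → k) :
    (∑ i, v i • (X i : PS k 2)) ^ 3 = binaryForm 3 (cubeCoeff (v 0) (v 1)) := by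
  rw [Fin.sum_univ_two, binaryForm, Fin.sum_univ_four]
  simp only [cubeCoeff, Algebra.smul_def, Matrix.cons_val, map_mul, map_pow, map_ofNat,
    Fin.val_zero, Fin.val_one, Fin.val_two]
  norm_num
  ring

theorem binaryForm_eq_zero_iff {j : ℕ} {c : Fin (j + 1) → k} : binaryForm j c = 0 ↔ c = 0 := by
  refine ⟨fun h => ?_, ?_⟩
  · rw [← formCoeff_binaryForm j c, h]
    exact funext fun l => map_zero _
  · rintro rfl
    simp [binaryForm]

variable {f : Module.Dual k (PS k 2)}

theorem X_pow_mul_X_pow_mem {d p q : ℕ} (h : d ≤ p + q) :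
    (X 0 ^ p * X 1 ^ q : PS k 2) ∈ maxIdeal k 2 ^ d := by
  refine Ideal.pow_le_pow_right h ?_
  rw [pow_add]
  exact Ideal.mul_mem_mul (Ideal.pow_mem_pow (X_mem_maxIdeal 0) p)
    (Ideal.pow_mem_pow (X_mem_maxIdeal 1) q)

theorem topCoeff_homPart {d : ℕ} (hf : f ∈ dpLT k 2 (d + 1)) :
    topCoeff d (homPart d f) = topCoeff d f :=
  funext fun l => homPart_apply_of_mem hf (X_pow_mul_X_pow_mem (by lia))

theorem hasHilbertFunction_h123321_iff (hf : f ∈ dpLT k 2 6) :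
    HasHilbertFunction k (Apolar f) h123321 ↔ apolarCubic (topCoeff 5 f) ≠ 0 := by
  rw [h123321_eq, hasHilbertFunction_compressed_iff three_ne_zero hf, isCompressed_three_iff hf,
    apolarCubic, maximalMinors_ne_zero_iff]

theorem hasHilbertFunction_of_hessian_ne_zero (hf : f ∈ dpLT k 2 6)
    (hess : hessian (apolarCubic (topCoeff 5 f)) ≠ 0) :
    HasHilbertFunction k (Apolar f) h123321 :=
  (hasHilbertFunction_h123321_iff hf).2 fun h => hess (by rw [h, hessian_zero])

theorem cubicNotPower_of_hessian_ne_zero (hf : f ∈ dpLT k 2 6)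
    (hess : hessian (apolarCubic (topCoeff 5 f)) ≠ 0) : CubicNotPower (homPart 5 f) := by
  rintro _ hc hne - v rfl
  rw [sum_smul_X_pow_three] at hc hne
  have hrow := (isCompressed_three_iff hf).1 (isCompressed_of_hessian_ne_zero hf hess)
  obtain ⟨t, ht⟩ := (mulVec_eq_zero_iff_exists_smul_maximalMinors hrow).1
    ((binaryForm_mem_apolarIdeal_homPart_iff (i := 2) (j := 3) hf _).1 hc)
  have ht0 : t ^ 2 • hessian (apolarCubic (topCoeff 5 f)) = 0 := by
    rw [← hessian_smul, apolarCubic, ← ht, hessian_cubeCoeff]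
  rw [smul_eq_zero_iff_left hess, pow_eq_zero_iff two_ne_zero] at ht0
  exact hne (binaryForm_eq_zero_iff.2 (by rw [ht, ht0, zero_smul]))

theorem hessian_ne_zero_of_cubicNotPower (h3 : (3 : k) ≠ 0) (hcube : ∀ a : k, ∃ b, b ^ 3 = a)
    (hf : f ∈ dpLT k 2 6) (hC : apolarCubic (topCoeff 5 f) ≠ 0)
    (hpow : CubicNotPower (homPart 5 f)) : hessian (apolarCubic (topCoeff 5 f)) ≠ 0 := by
  intro h
  obtain ⟨u, v, huv⟩ := exists_eq_cubeCoeff h3 hcube h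
  exact hpow (binaryForm 3 (apolarCubic (topCoeff 5 f)))
    ((binaryForm_mem_apolarIdeal_homPart_iff (i := 2) (j := 3) hf _).2 (mulVec_maximalMinors _))
    (mt binaryForm_eq_zero_iff.1 hC) (homogeneousComponent_binaryForm 3 _) ![u, v]
    (by rw [sum_smul_X_pow_three, huv]; rfl)

theorem hessian_ne_zero_iff (h3 : (3 : k) ≠ 0) (hcube : ∀ a : k, ∃ b, b ^ 3 = a)
    (hf : f ∈ dpLT k 2 6) : hessian (apolarCubic (topCoeff 5 f)) ≠ 0 ↔
      HasHilbertFunction k (Apolar f) h123321 ∧ CubicNotPower (homPart 5 f) := by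
  refine ⟨fun h => ⟨hasHilbertFunction_of_hessian_ne_zero hf h,
    cubicNotPower_of_hessian_ne_zero hf h⟩, fun h => ?_⟩
  exact hessian_ne_zero_of_cubicNotPower h3 hcube hf ((hasHilbertFunction_h123321_iff hf).1 h.1) h.2

end CubicNotPower

section ZariskiOpen

variable (k : Type*) [Field k]

theorem isZariskiOpen_hessian_ne_zero :
    IsZariskiOpen {f : dpLE k 2 5 | hessian (apolarCubic (topCoeff 5 f.1)) ≠ 0} := by
  let W : ℕ → MvPolynomial {a : Fin 2 →₀ ℕ // a.degree ≤ 5} k := fun l =>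
    if h : (Finsupp.single 0 (5 - l) + Finsupp.single 1 l : Fin 2 →₀ ℕ).degree ≤ 5 then
      MvPolynomial.X ⟨_, h⟩ else 0
  refine ⟨Ideal.span (Set.range (hessian (apolarCubic W))), fun f => ?_⟩
  let eval : MvPolynomial {a : Fin 2 →₀ ℕ // a.degree ≤ 5} k →+* k :=
    (MvPolynomial.aeval fun a => f.1 (monomial a.1 1)).toRingHom
  have hW : eval ∘ W = topCoeff 5 f.1 := by
    ext l
    by_cases h : (Finsupp.single 0 (5 - l) + Finsupp.single 1 l : Fin 2 →₀ ℕ).degree ≤ 5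
    · rw [Function.comp_apply, topCoeff, X_pow_eq, X_pow_eq, monomial_mul_monomial, one_mul]
      simp only [W, dif_pos h]
      exact MvPolynomial.aeval_X _ _
    · have hzero : topCoeff 5 f.1 l = 0 := by
        rw [map_add, Finsupp.degree_single, Finsupp.degree_single] at h
        exact mem_dpLT.1 ((dpLE_eq_dpLT 5).le f.2) _ (X_pow_mul_X_pow_mem (by lia))
      simp only [Function.comp_apply, W, dif_neg h, map_zero, hzero]
  have hpoly : eval ∘ hessian (apolarCubic W) = hessian (apolarCubic (topCoeff 5 f.1)) := by
    rw [map_hessian, map_apolarCubic, hW]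
  rw [MvPolynomial.zeroLocus_span, Set.mem_ofPred_eq, not_iff_not, Set.mem_ofPred_eq,
    Set.forall_mem_range, ← hpoly, funext_iff]
  rfl

theorem exists_mem_dpLE_hessian_ne_zero :
    ∃ f ∈ dpLE k 2 5, hessian (apolarCubic (topCoeff 5 f)) ≠ 0 := by
  let a (i j : ℕ) : Fin 2 →₀ ℕ := Finsupp.single 0 i + Finsupp.single 1 j
  refine ⟨dpMonomial k (a 5 0) + dpMonomial k (a 1 4),
    add_mem (Submodule.subset_span ⟨_, ?_, rfl⟩) (Submodule.subset_span ⟨_, ?_, rfl⟩), fun h => ?_⟩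
  · simp [a]
  · simp [a]
  · have := congrFun h 0
    simp [a, hessian, apolarCubic, maximalMinors, hankel, topCoeff, dpMonomial,
      coeff_X_pow_mul_X_pow, Matrix.det_fin_three, Fin.succAbove] at this

variable {k}

theorem notMem_dpLT_of_hessian_ne_zero {f : Module.Dual k (PS k 2)}
    (hess : hessian (apolarCubic (topCoeff 5 f)) ≠ 0) : f ∉ dpLT k 2 5 := by
  intro hf
  have htop : topCoeff 5 f = 0 := funext fun l => mem_dpLT.1 hf _ (X_pow_mul_X_pow_mem (by lia))
  have hC : apolarCubic (topCoeff 5 f) ≠ 0 := fun h => hess (by rw [h, hessian_zero])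
  exact (maximalMinors_ne_zero_iff.1 hC).ne_zero 0 (by rw [htop]; rfl)

end ZariskiOpen

theorem natCast_ne_zero_of_le_of_lt_ringChar {R : Type*} [NonAssocSemiring R] {m N : ℕ}
    (hchar : ringChar R = 0 ∨ N < ringChar R) (hm : m ≠ 0) (hmN : m ≤ N) : (m : R) ≠ 0 := by
  intro h
  have hdvd := (ringChar.spec R m).1 h
  rcases hchar with h0 | hN
  · exact hm (zero_dvd_iff.1 (h0 ▸ hdvd))
  · have := Nat.le_of_dvd (Nat.pos_of_ne_zero hm) hdvd
    lia

end Macaulay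

theorem mainTheorem11_general (k : Type*) [Field k] (h2 : (2 : k) ≠ 0) (h3 : (3 : k) ≠ 0)
    (hcube : ∀ a : k, ∃ b, b ^ 3 = a) :
    ∃ U : Set (Macaulay.dpLE k 2 5),
      Macaulay.IsZariskiOpen U ∧ U.Nonempty ∧
      (∀ f : Macaulay.dpLE k 2 5, f ∈ U ↔
        Macaulay.HasHilbertFunction k (Macaulay.Apolar f.1) Macaulay.h123321 ∧
        Macaulay.CubicNotPower (Macaulay.homPart 5 f.1)) ∧
      ∀ f ∈ U,
        f.1 ∉ Macaulay.dpLE k 2 4 ∧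
        Macaulay.HasHilbertFunction k (Macaulay.Apolar f.1) Macaulay.h123321 ∧
        Macaulay.HasHilbertFunction k
          (Macaulay.Apolar (Macaulay.homPart 5 f.1)) Macaulay.h123321 ∧
        Macaulay.gPlusOrbit (Macaulay.homPart 5 f.1) =
          {g | g - Macaulay.homPart 5 f.1 ∈ Macaulay.dpLE k 2 4} ∧
        Nonempty (Macaulay.Apolar f.1 ≃ₐ[k] Macaulay.Apolar (Macaulay.homPart 5 f.1)) ∧
        Macaulay.IsCanonicallyGraded k (Macaulay.Apolar f.1) := by
  obtain ⟨f₀, hf₀, hess₀⟩ := Macaulay.exists_mem_dpLE_hessian_ne_zero k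
  refine ⟨_, Macaulay.isZariskiOpen_hessian_ne_zero k, ⟨⟨f₀, hf₀⟩, hess₀⟩,
    fun f => Macaulay.hessian_ne_zero_iff h3 hcube ((Macaulay.dpLE_eq_dpLT 5).le f.2),
    fun ⟨f, hmem⟩ (hess : Macaulay.hessian _ ≠ 0) => ?_⟩
  have hf : f ∈ Macaulay.dpLT k 2 6 := (Macaulay.dpLE_eq_dpLT 5).le hmem
  have hF := Macaulay.homPart_mem_dpLT 5 f
  have hessF := Macaulay.topCoeff_homPart hf ▸ hess
  have hilbert := Macaulay.hasHilbertFunction_of_hessian_ne_zero hf hess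
  have orbit := Macaulay.gPlusOrbit_eq_of_hessian_ne_zero h2 h3 hF hessF
  obtain ⟨φ⟩ := Macaulay.nonempty_algEquiv_of_mem_gPlusOrbit
    (orbit.symm.le (Macaulay.sub_homPart_mem_dpLT hf))
  have := hilbert.1
  rw [Macaulay.dpLE_eq_dpLT]
  exact ⟨Macaulay.notMem_dpLT_of_hessian_ne_zero hess, hilbert,
    Macaulay.hasHilbertFunction_of_hessian_ne_zero hF hessF, orbit, ⟨φ⟩,
    Macaulay.isCanonicallyGraded_of_algEquiv φ.symm⟩

theorem mainTheorem11 (k : Type*) [Field k] [IsAlgClosed k]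
    (hchar : ringChar k = 0 ∨ 5 < ringChar k) :
    ∃ U : Set (Macaulay.dpLE k 2 5),
      Macaulay.IsZariskiOpen U ∧ U.Nonempty ∧
      (∀ f : Macaulay.dpLE k 2 5, f ∈ U ↔
        Macaulay.HasHilbertFunction k (Macaulay.Apolar f.1) Macaulay.h123321 ∧
        Macaulay.CubicNotPower (Macaulay.homPart 5 f.1)) ∧
      ∀ f ∈ U,
        f.1 ∉ Macaulay.dpLE k 2 4 ∧
        Macaulay.HasHilbertFunction k (Macaulay.Apolar f.1) Macaulay.h123321 ∧
        Macaulay.HasHilbertFunction k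
          (Macaulay.Apolar (Macaulay.homPart 5 f.1)) Macaulay.h123321 ∧
        Macaulay.gPlusOrbit (Macaulay.homPart 5 f.1) =
          {g | g - Macaulay.homPart 5 f.1 ∈ Macaulay.dpLE k 2 4} ∧
        Nonempty (Macaulay.Apolar f.1 ≃ₐ[k] Macaulay.Apolar (Macaulay.homPart 5 f.1)) ∧
        Macaulay.IsCanonicallyGraded k (Macaulay.Apolar f.1) := by
  have h2 := Macaulay.natCast_ne_zero_of_le_of_lt_ringChar hchar two_ne_zero (by lia)
  have h3 := Macaulay.natCast_ne_zero_of_le_of_lt_ringChar hchar three_ne_zero (by lia)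
  exact mainTheorem11_general k (mod_cast h2) (mod_cast h3)
    fun a => IsAlgClosed.exists_pow_nat_eq a three_pos
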